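/- **Setting.** A signature consists of relation symbols $R$ with arities. A structure $\mathcal A$ assigns to each symbol $R$ a finite relation $R^{\mathcal A}\subseteq\mathbb N^{\mathrm{ar}(R)}$. Let $Q(v_0,\dots,v_{k-1})$ be a full conjunctive query, i.e. a conjunction of finitely many atoms without quantifiers or constants, such that every variable occurs in some atom, every atom has at least one argument, the argument list of each atom is a subsequence of the variable ordering $[v_0,\dots,v_{k-1}]$ without repetitions, and no relation symbol occurs twice. $Q^{\mathcal A}\subseteq\mathbb N^k$ is the set of satisfying assignments. *Renumbering.* View a relation $R\subseteq\mathbb N^r$ as a trie whose root-to-leaf paths are the tuples. Renumbering $R$ at depth $d\in\{0,\dots,r-1\}$ replaces each tuple $(t_0,\dots,t_{r-1})\in R$ by $(t_0,\dots,t_{d-1},\rho,0,\dots,0)$, where $\rho$ is the number of $x<t_d$ such that $(t_0,\dots,t_{d-1},x)$ is a prefix of a tuple of $R$ (duplicates are removed). A structure $\mathcal A'$ is a renumbering of $\mathcal A$ if it arises by renumbering one relation of $\mathcal A$ at one depth. A family of problem instances is a sequence $(\mathbf K_n)_{n\in\mathbb N}$ of classes of structures with $\mathbf K_i\subseteq\mathbf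 K_j$ for $i\le j$; it is closed under renumbering if $\mathcal A\in\mathbf K_n$ implies $\mathcal A'\in\mathbf K_n$ for every renumbering $\mathcal A'$ of $\mathcal A$. *Leapfrog triejoin.* Each atom has one trie iterator on its relation, starting at the root of the trie. $\mathrm{open}()$ moves to the first (least) child key of the current node (to the end if there is none), $\mathrm{up}()$ returns to the parent, $\mathrm{next}()$ moves to the next larger sibling key, $\mathrm{seek}(s)$ to the least sibling key $\ge s$ (to the end if there is none); $\mathrm{key}()$ and $\mathrm{atEnd}()$ report the current key and whether the iterator is at the end. The leapfrog join of $v_i$ uses an array $\mathrm{Iter}[0..\ell-1]$ of the iterators of all atoms that contain $v_i$, and an index $p$: - *init*: if some iterator is at its end, the join is at its end; otherwise sort $\mathrm{Iter}$ by current key, set $p:=0$ and do *search*. - *search*: set $x':=\mathrm{Iter}[(p-1)\bmod \ell].\mathrm{key}()$ and repeat: if $\mathrm{Iter}[p].\mathrm{key}()=x'$, present the key $x'$ and return; otherwise do $\mathrm{Iter}[p].\mathrm{seek}(x')$; if this iterator is now at its end, the join is at its end, return; otherwise set $x':=\mathrm{Iter}[p].\mathrm{key}()$, $p:=(p+1)\bmod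 \ell$. - *next*: do $\mathrm{Iter}[p].\mathrm{next}()$; if this iterator is now at its end, the join is at its end; otherwise set $p:=(p+1)\bmod \ell$ and do *search*. To *open* the variable $v_i$ means to apply $\mathrm{open}()$ to all iterators of its join and then do *init*; to *close* it means to apply $\mathrm{up}()$ to all of them. The algorithm searches for bindings of $v_0,\dots,v_{k-1}$ depth first: it opens $v_0$; when the join of the current variable $v_i$ presents a key, it opens $v_{i+1}$ if $i<k-1$, and outputs the tuple of presented keys and does *next* if $i=k-1$; when the join of $v_i$ is at its end, it closes $v_i$ and does *next* on the join of $v_{i-1}$ if $i>0$, and halts if $i=0$. (If $k=0$ it outputs the empty tuple and halts.) *Time.* On an iterator for a relation with $N$ tuples, each of $\mathrm{open},\mathrm{up},\mathrm{next},\mathrm{seek}$ takes an arbitrary time (possibly dependent on everything that happened before) of at most $\kappa\cdot\max(1,\log_2 N)$. Every other elementary operation takes unit time, and sorting an array of length $\ell$ takes time $\ell^2$. **Theorem.** Let $Q$ be as above and let $\kappa\in\mathbb R$. There is a constant $C$, depending only on $Q$ and $\kappa$, such that the following holds. Let $(\mathbf K_n)_{n\in\mathbb N}$ be a family of problem instances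 closed under renumbering for which, for every $n$, the numbers $$q(n)=\max_{\mathcal A\in\mathbf K_n}|Q^{\mathcal A}|,\qquad M(n)=\max_{\mathcal A\in\mathbf K_n}\max_R|R^{\mathcal A}|$$ exist (the maximum of the empty set is $0$). Then for every $n$ and every $\mathcal A\in\mathbf K_n$, leapfrog triejoin with the variable ordering $[v_0,\dots,v_{k-1}]$, run on $\mathcal A$ with iterators as above, halts and outputs every element of $Q^{\mathcal A}$ exactly once and nothing else. If moreover there is a $\mathcal B\in\mathbf K_n$ with $\emptyset\ne R^{\mathcal B}\supseteq R^{\mathcal A}$ for every relation symbol $R$ of $Q$ (for instance $\mathcal B=\mathcal A$, if no relation of $\mathcal A$ in the query is empty), then its running time is at most $$C\cdot q(n)\cdot\max(1,\log_2 M(n)),$$ i.e. it is $O(q(n)\log M(n))$. -/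

import Mathlib

namespace LFTJ

/-! ## Instances, queries, renumbering -/

/-- A finite relational structure over `ℕ` for the signature with relation symbols `σ` and
arities `ar`: a finite relation for every symbol.  (The universe plays no role for a full
conjunctive query, so it is not recorded.) -/
abbrev Str {σ : Type*} (ar : σ → ℕ) : Type _ := (R : σ) → Finset (Fin (ar R) → ℕ)

/-- A full conjunctive query in the variables `v_0, …, v_{k-1}` (in this variable ordering)
that meets the syntactic restrictions of leapfrog triejoin. -/
structure Query {σ : Type*} (ar : σ → ℕ) (k : ℕ) where
  /-- number of atoms -/
  m : ℕ
  /-- relation symbol of an atom -/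
  rel : Fin m → σ
  /-- no relation symbol is used twice -/
  rel_injective : Function.Injective rel
  /-- argument list of an atom; constants are not allowed -/
  vars : (a : Fin m) → Fin (ar (rel a)) → Fin k
  /-- an argument list is a subsequence of the variable ordering, without repetitions -/
  vars_strictMono : ∀ a, StrictMono (vars a)
  /-- every atom has at least one argument -/
  arity_pos : ∀ a, 0 < ar (rel a)
  /-- every variable occurs in some atom -/
  covers : ∀ v : Fin k, ∃ a j, vars a j = v

section QueryBasics

variable {σ : Type*} {ar : σ → ℕ} {k : ℕ}

/-- The query result: all satisfying assignments of the conjunction. -/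
def Query.result (Q : Query ar k) (A : Str ar) : Set (Fin k → ℕ) :=
  {t | ∀ a : Fin Q.m, (fun j => t (Q.vars a j)) ∈ A (Q.rel a)}

/-- The result is finite, so that `Set.ncard` is its true number of elements. -/
theorem Query.result_finite (Q : Query ar k) (A : Str ar) : (Q.result A).Finite := by
  classical
  have h : Set.InjOn (fun (t : Fin k → ℕ) (a : Fin Q.m) (j : Fin (ar (Q.rel a))) =>
      t (Q.vars a j)) (Q.result A) := by
    intro s _ t _ hst
    funext v
    obtain ⟨a, j, rfl⟩ := Q.covers v
    exact congrFun (congrFun hst a) j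
  refine Set.Finite.of_finite_image (Set.Finite.subset
    (Set.Finite.pi' (fun a : Fin Q.m => (A (Q.rel a)).finite_toSet)) ?_) h
  rintro _ ⟨t, ht, rfl⟩ a
  exact ht a

/-- The atoms that contain the variable `v_i`, i.e. those that take part in the leapfrog join
for `v_i`. -/
def Query.atomsAt (Q : Query ar k) (i : ℕ) : List (Fin Q.m) :=
  (List.finRange Q.m).filter fun a => decide (∃ j, (Q.vars a j : ℕ) = i)

end QueryBasics

/-- In the trie of `R`, the keys of the children of the node at the end of the path
`path 0, …, path (d - 1)`. -/
def children {r : ℕ} (R : Finset (Fin r → ℕ)) (d : Fin r) (path : Fin r → ℕ) : Finset ℕ :=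
  (R.filter fun t => ∀ j, j < d → t j = path j).image fun t => t d

/-- Renumbering of `R` at depth `d`: the children of every node at depth `d - 1` are
renumbered `0, 1, …` in increasing order, all later entries become `0`, and duplicates
disappear. -/
def renumber {r : ℕ} (R : Finset (Fin r → ℕ)) (d : Fin r) : Finset (Fin r → ℕ) :=
  R.image fun t j =>
    if j < d then t j
    else if j = d then ((children R d t).filter fun x => x < t d).card
    else 0

/-- `A'` arises from `A` by renumbering one relation at one depth. -/
def IsRenumbering {σ : Type*} {ar : σ → ℕ} (A A' : Str ar) : Prop :=
  ∃ (R : σ) (d : Fin (ar R)), A' R = renumber (A R) d ∧ ∀ S, S ≠ R → A' S = A S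

/-- A class of structures that is closed under renumbering. -/
def ClosedUnderRenumbering {σ : Type*} {ar : σ → ℕ} (𝒦 : Set (Str ar)) : Prop :=
  ∀ A ∈ 𝒦, ∀ A', IsRenumbering A A' → A' ∈ 𝒦

/-! ## Trie iterators -/

/-- Position of a trie iterator for a relation of arity `r`.  `depth = 0` is the root; at
depth `d + 1` the iterator stands at the key `keys d` among the children of the node
`keys 0, …, keys (d - 1)`, or behind all of them if `atEnd` is set. -/
structure TrieIter (r : ℕ) where
  depth : ℕ
  keys : Fin r → ℕ
  atEnd : Bool

namespace TrieIter

variable {r : ℕ}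

/-- The position at initialization. -/
def root (r : ℕ) : TrieIter r := ⟨0, fun _ => 0, false⟩

/-- Stand at the least key `≥ lb` among the children of the node `keys 0, …, keys (d - 1)`,
or at the end if there is none. -/
def place (R : Finset (Fin r → ℕ)) (keys : Fin r → ℕ) (d : Fin r) (lb : ℕ) : TrieIter r :=
  if h : ((children R d keys).filter fun x => lb ≤ x).Nonempty then
    ⟨d + 1, Function.update keys d (((children R d keys).filter fun x => lb ≤ x).min' h), false⟩
  else ⟨d + 1, keys, true⟩

/-- `key()` -/
def key (it : TrieIter r) : ℕ :=
  match it.depth with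
  | 0 => 0
  | d + 1 => if h : d < r then it.keys ⟨d, h⟩ else 0

/-- `open()`: proceed to the first key at the next depth. -/
def down (R : Finset (Fin r → ℕ)) (it : TrieIter r) : TrieIter r :=
  if h : it.depth < r then place R it.keys ⟨it.depth, h⟩ 0 else it

/-- `up()`: return to the parent key at the previous depth. -/
def up (it : TrieIter r) : TrieIter r := ⟨it.depth - 1, it.keys, false⟩

/-- `seek(seekKey)`: proceed to the least key `≥ seekKey` among the siblings. -/
def seek (R : Finset (Fin r → ℕ)) (seekKey : ℕ) (it : TrieIter r) : TrieIter r :=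
  match it.depth with
  | 0 => it
  | d + 1 => if h : d < r then place R it.keys ⟨d, h⟩ seekKey else it

/-- `next()`: proceed to the next key among the siblings. -/
def next (R : Finset (Fin r → ℕ)) (it : TrieIter r) : TrieIter r :=
  it.seek R (it.key + 1)

end TrieIter

/-- The iterator methods whose running time is only required to be logarithmic. -/
inductive IterOp
  | down | up | next | seek

/-! ## The algorithm, as a machine with a clock -/

/-- State of the leapfrog join of one variable. -/
structure Join (m : ℕ) where
  /-- the array `Iter` of pointers to trie iterators, one for each atom with this variable -/
  iters : List (Fin m)
  /-- the index `p` into this array -/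
  p : ℕ
  /-- the variable `x'` of leapfrog-search -/
  maxKey : ℕ
  /-- the key presented by the join -/
  key : ℕ
  /-- the join is at its end -/
  atEnd : Bool

/-- Program positions. `visit`, `test`, `advance` are the depth-first walk through the trie
presented by the triejoin; `descend` and `ascend` are triejoin-open and triejoin-up; `init`,
`search` (the line before the loop), `loop` (the loop of leapfrog-search) and `advance` are the
methods of the leapfrog join of the current variable. -/
inductive PC
  | visit | descend | init | search | loop | test | ascend | advance | halt

/-- A configuration of leapfrog triejoin. -/
structure Config {σ : Type*} {ar : σ → ℕ} {k : ℕ} (Q : Query ar k) where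
  pc : PC
  /-- number of opened variables; the current variable is `v_{level - 1}` -/
  level : ℕ
  /-- the trie iterators, one for each atom, shared by the leapfrog joins -/
  iter : (a : Fin Q.m) → TrieIter (ar (Q.rel a))
  /-- the leapfrog joins; entry `i` belongs to the variable `v_i` -/
  join : ℕ → Join Q.m
  /-- the tuples produced so far, latest first -/
  out : List (Fin k → ℕ)
  /-- time elapsed -/
  time : ℕ

section Machine

variable {σ : Type*} {ar : σ → ℕ} {k : ℕ} {Q : Query ar k}

/-- The initial configuration. -/
def start (Q : Query ar k) : Config Q where
  pc := .visit
  level := 0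
  iter := fun a => TrieIter.root (ar (Q.rel a))
  join := fun i => ⟨Q.atomsAt i, 0, 0, 0, false⟩
  out := []
  time := 0

/-- Running times of the trie iterator methods: `τ c a op` is the time that the method `op` of
the iterator for atom `a` takes when it is called in configuration `c`.  (As `c` includes the
clock, the time may depend on everything that happened before.) -/
abbrev IterTime (Q : Query ar k) : Type _ := Config Q → Fin Q.m → IterOp → ℕ

/-- The requirement on trie iterators: every method takes time `O(log N)` with the constant `κ`,
where `N` is the cardinality of the relation (and time `O(1)` if `N ≤ 2`). -/
def IterTime.Meets (τ : IterTime Q) (κ : ℝ) (A : Str ar) : Prop :=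
  ∀ c a op, (τ c a op : ℝ) ≤ κ * max 1 (Real.logb 2 (A (Q.rel a)).card)

/-- Execution of the program position of `c`.  Every elementary operation, including the
iterator methods `key()` and `atEnd()`, takes one unit of time; the iterator methods `open()`,
`up()`, `next()` and `seek()` take the time given by `τ`; sorting an array of length `n` takes
`n ^ 2`. -/
def step (A : Str ar) (τ : IterTime Q) (c : Config Q) : Config Q :=
  -- index of the current variable, and its leapfrog join
  let i := c.level - 1
  let J := c.join i
  let n := J.iters.length
  match c.pc with
  | .visit =>
      -- all variables are bound: produce the binding; otherwise go one level deeper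
      if c.level = k then
        { c with
          out := (fun v => (c.join v).key) :: c.out
          pc := .advance
          time := c.time + (k + 2) }
      else { c with pc := .descend, time := c.time + 1 }
  | .descend =>
      { c with
        level := c.level + 1
        iter := fun a =>
          if a ∈ Q.atomsAt c.level then (c.iter a).down (A (Q.rel a)) else c.iter a
        pc := .init
        time := c.time + 1 + ((Q.atomsAt c.level).map fun a => 1 + τ c a .down).sum }
  | .init =>
      if J.iters.any fun a => (c.iter a).atEnd then
        { c with
          join := Function.update c.join i { J with atEnd := true }
          pc := .test
          time := c.time + (n + 2) }
      else
        { c with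
          join := Function.update c.join i
            { J with
              iters := J.iters.insertionSort fun a b => (c.iter a).key ≤ (c.iter b).key
              p := 0
              atEnd := false }
          pc := .search
          time := c.time + (n + 3 + n ^ 2) }
  | .search =>
      match J.iters[(J.p + n - 1) % n]? with
      | none => { c with pc := .halt }
      | some b =>
          { c with
            join := Function.update c.join i { J with maxKey := (c.iter b).key }
            pc := .loop
            time := c.time + 3 }
  | .loop =>
      match J.iters[J.p]? with
      | none => { c with pc := .halt }
      | some a =>
          if (c.iter a).key = J.maxKey then
            { c with
              join := Function.update c.join i { J with key := J.maxKey }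
              pc := .test
              time := c.time + 4 }
          else
            let it := (c.iter a).seek (A (Q.rel a)) J.maxKey
            if it.atEnd then
              { c with
                iter := Function.update c.iter a it
                join := Function.update c.join i { J with atEnd := true }
                pc := .test
                time := c.time + 5 + τ c a .seek }
            else
              { c with
                iter := Function.update c.iter a it
                join := Function.update c.join i
                  { J with maxKey := it.key, p := (J.p + 1) % n }
                pc := .loop
                time := c.time + 7 + τ c a .seek }
  | .test =>
      if J.atEnd then { c with pc := .ascend, time := c.time + 1 }
      else { c with pc := .visit, time := c.time + 1 }
  | .ascend =>
      { c with
        level := c.level - 1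
        iter := fun a => if a ∈ Q.atomsAt i then (c.iter a).up else c.iter a
        pc := .advance
        time := c.time + 1 + ((Q.atomsAt i).map fun a => 1 + τ c a .up).sum }
  | .advance =>
      -- at the root the walk is complete; otherwise leapfrog-next
      if c.level = 0 then { c with pc := .halt, time := c.time + 1 }
      else
        match J.iters[J.p]? with
        | none => { c with pc := .halt }
        | some a =>
            let it := (c.iter a).next (A (Q.rel a))
            if it.atEnd then
              { c with
                iter := Function.update c.iter a it
                join := Function.update c.join i { J with atEnd := true }
                pc := .test
                time := c.time + 4 + τ c a .next }
            else
              { c with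
                iter := Function.update c.iter a it
                join := Function.update c.join i { J with p := (J.p + 1) % n }
                pc := .search
                time := c.time + 4 + τ c a .next }
  | .halt => c

/-- On input `A`, leapfrog triejoin halts in the configuration `c`. -/
def HaltsAt (A : Str ar) (τ : IterTime Q) (c : Config Q) : Prop :=
  c.pc = .halt ∧ ∃ N : ℕ, c = (step A τ)^[N] (start Q)

end Machine

end LFTJ

/-! The time bound rests on a comparison of two counts at each node of the search. Fix a variable
`v_i` and values `t` for the earlier variables that are consistent with the relations. At this node
every atom containing `v_i` has a set of candidate keys (`Query.cand`).

Leapfrogging costs at most a constant times `m` times the size of any one of these sets. Take an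
atom `b`: the iterators move in cyclic order, so `b` moves at least once in every `m` moves, and
whenever it moves it passes at least one of its own keys. This is the role of `potential`, which
falls with every move (`Leapfrogging.exists_potential_lt`, used in `returns_of_loop`).

The smallest candidate set is paid for by query results of a renumbered structure. Renumber all
relations of `B` at the depths they have reached before `v_i`. The children of each node become an
initial segment of the naturals and everything deeper becomes `0`. If `x` is below the size of each
candidate set, then `t` followed by `x, 0, ..., 0` satisfies every atom of the renumbered structure
(`Query.RenumberedAt.mem_result`). Hence the smallest candidate set is no larger than the set of
those results that extend `t` (`Query.RenumberedAt.exists_card_cand_le`).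

The renumbered structure depends on `i` but not on `t`, and different nodes of one level are
extended by disjoint sets of results. So the work at level `i` is bounded by a multiple of one
result size, which is at most `q n` by closure under renumbering. Summing over the levels gives a
constant times `q n` machine steps; the additive constant is absorbed because `q n` is at least one.
A single step costs at most a constant times `max 1 (log M)`.

Correctness is proved by the same induction: a seek skips only values absent from some candidate
set, so no result is lost, and the presented keys increase strictly, so none is repeated. -/

namespace LFTJ

/-! ### Candidate keys, renumbering, and counting against query results. -/

section Counting

variable {σ : Type*} {ar : σ → ℕ} {k : ℕ} (Q : Query ar k)

/-- The number of arguments of the atom `a` among the first `i` variables. -/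
def Query.depthAt (a : Fin Q.m) (i : ℕ) : ℕ :=
  (Finset.univ.filter fun j => (Q.vars a j : ℕ) < i).card

variable {Q}

/-- Argument lists are increasing, so the arguments bound before `v_i` form an initial segment.
Counting them therefore gives a depth in the trie of the atom. -/
theorem Query.lt_depthAt_iff {a : Fin Q.m} {i : ℕ} {j : Fin (ar (Q.rel a))} :
    (j : ℕ) < Q.depthAt a i ↔ (Q.vars a j : ℕ) < i := by
  constructor
  · intro h
    by_contra hn
    have : (Finset.univ.filter fun j => (Q.vars a j : ℕ) < i) ⊆ Finset.Iio j := by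
      intro j' hj'
      rw [Finset.mem_filter] at hj'
      rw [Finset.mem_Iio]
      by_contra hle
      have := (Q.vars_strictMono a).monotone (not_lt.1 hle)
      have : (Q.vars a j : ℕ) ≤ Q.vars a j' := this
      omega
    have := Finset.card_le_card this
    rw [Fin.card_Iio] at this
    exact absurd h (not_lt.2 this)
  · intro h
    have : Finset.Iic j ⊆ (Finset.univ.filter fun j => (Q.vars a j : ℕ) < i) := by
      intro j' hj'
      rw [Finset.mem_Iic] at hj'
      have : (Q.vars a j' : ℕ) ≤ Q.vars a j := (Q.vars_strictMono a).monotone hj'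
      rw [Finset.mem_filter]
      exact ⟨Finset.mem_univ _, by omega⟩
    have := Finset.card_le_card this
    rw [Fin.card_Iic] at this
    exact this

theorem Query.depthAt_le (a : Fin Q.m) (i : ℕ) : Q.depthAt a i ≤ ar (Q.rel a) :=
  (Finset.card_filter_le _ _).trans_eq (Finset.card_fin _)

theorem Query.depthAt_zero (a : Fin Q.m) : Q.depthAt a 0 = 0 := by simp [Query.depthAt]

theorem Query.depthAt_eq_of_vars_eq {a : Fin Q.m} {i : ℕ} {j : Fin (ar (Q.rel a))}
    (h : (Q.vars a j : ℕ) = i) : Q.depthAt a i = j := by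
  apply le_antisymm
  · by_contra hn
    have := Q.lt_depthAt_iff.1 (not_le.1 hn)
    omega
  · by_contra hn
    let j' : Fin (ar (Q.rel a)) := ⟨Q.depthAt a i, by omega⟩
    have h1 : j' < j := not_le.1 hn
    have h2 : (Q.vars a j' : ℕ) < Q.vars a j := Q.vars_strictMono a h1
    rw [h] at h2
    exact lt_irrefl _ (Q.lt_depthAt_iff.2 h2)

theorem Query.mem_atomsAt {a : Fin Q.m} {i : ℕ} :
    a ∈ Q.atomsAt i ↔ ∃ j, (Q.vars a j : ℕ) = i := by
  simp [Query.atomsAt]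

theorem Query.nodup_atomsAt (i : ℕ) : (Q.atomsAt i).Nodup :=
  (List.nodup_finRange _).filter _

theorem Query.length_atomsAt_le (i : ℕ) : (Q.atomsAt i).length ≤ Q.m :=
  (List.length_filter_le _ _).trans_eq List.length_finRange

theorem Query.exists_mem_atomsAt {i : ℕ} (hi : i < k) : ∃ a, a ∈ Q.atomsAt i := by
  obtain ⟨a, j, h⟩ := Q.covers ⟨i, hi⟩
  exact ⟨a, Query.mem_atomsAt.2 ⟨j, by rw [h]⟩⟩

theorem Query.depthAt_lt_of_mem {a : Fin Q.m} {i : ℕ} (h : a ∈ Q.atomsAt i) :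
    Q.depthAt a i < ar (Q.rel a) := by
  obtain ⟨j, hj⟩ := Query.mem_atomsAt.1 h
  rw [Query.depthAt_eq_of_vars_eq hj]
  exact j.2

theorem Query.vars_depthAt_of_mem {a : Fin Q.m} {i : ℕ} (h : a ∈ Q.atomsAt i)
    (d : Fin (ar (Q.rel a))) (hd : (d : ℕ) = Q.depthAt a i) : (Q.vars a d : ℕ) = i := by
  obtain ⟨j, hj⟩ := Query.mem_atomsAt.1 h
  rw [Query.depthAt_eq_of_vars_eq hj] at hd
  rw [Fin.ext hd, hj]

theorem Query.depthAt_succ_of_mem {a : Fin Q.m} {i : ℕ} (h : a ∈ Q.atomsAt i) :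
    Q.depthAt a (i + 1) = Q.depthAt a i + 1 := by
  obtain ⟨j, hj⟩ := Query.mem_atomsAt.1 h
  rw [Query.depthAt_eq_of_vars_eq hj]
  apply le_antisymm
  · by_contra hn
    have hle := Q.depthAt_le a (i + 1)
    let j' : Fin (ar (Q.rel a)) := ⟨j + 1, by omega⟩
    have h1 : (Q.vars a j' : ℕ) < i + 1 :=
      Q.lt_depthAt_iff.1 (show (j : ℕ) + 1 < _ from not_le.1 hn)
    have h2 : (Q.vars a j : ℕ) < Q.vars a j' :=
      Q.vars_strictMono a (Fin.lt_def.2 (Nat.lt_succ_self _))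
    omega
  · exact Q.lt_depthAt_iff.2 (by omega)

theorem Query.vars_lt_succ_iff_of_not_mem {a : Fin Q.m} {i : ℕ} (h : a ∉ Q.atomsAt i)
    (j : Fin (ar (Q.rel a))) : (Q.vars a j : ℕ) < i + 1 ↔ (Q.vars a j : ℕ) < i := by
  have : (Q.vars a j : ℕ) ≠ i := fun e => h (Query.mem_atomsAt.2 ⟨j, e⟩)
  omega

theorem Query.depthAt_succ_of_not_mem {a : Fin Q.m} {i : ℕ} (h : a ∉ Q.atomsAt i) :
    Q.depthAt a (i + 1) = Q.depthAt a i := by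
  simp only [Query.depthAt, Query.vars_lt_succ_iff_of_not_mem h]

theorem children_congr {r : ℕ} {R : Finset (Fin r → ℕ)} {d : Fin r} {s t : Fin r → ℕ}
    (h : ∀ j, j < d → s j = t j) : children R d s = children R d t := by
  unfold children
  congr 1
  apply Finset.filter_congr
  intro u _
  exact forall₂_congr fun j hj => by rw [h j hj]

theorem mem_children {r : ℕ} {R : Finset (Fin r → ℕ)} {d : Fin r} {s : Fin r → ℕ} {x : ℕ} :
    x ∈ children R d s ↔ ∃ u ∈ R, (∀ j, j < d → u j = s j) ∧ u d = x := by
  simp [children, and_assoc]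

variable (Q) in
/-- The keys below the node that the atom `a` reaches with the values that `t` gives to the
variables before `v_i`. -/
def Query.cand (A : Str ar) (t : ℕ → ℕ) (a : Fin Q.m) (i : ℕ) : Finset ℕ :=
  if h : Q.depthAt a i < ar (Q.rel a) then
    children (A (Q.rel a)) ⟨Q.depthAt a i, h⟩ fun j => t (Q.vars a j)
  else ∅

theorem Query.mem_cand {A : Str ar} {t : ℕ → ℕ} {a : Fin Q.m} {i x : ℕ} :
    x ∈ Q.cand A t a i ↔ ∃ u ∈ A (Q.rel a), ∃ d : Fin (ar (Q.rel a)), (d : ℕ) = Q.depthAt a i ∧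
      (∀ j, (Q.vars a j : ℕ) < i → u j = t (Q.vars a j)) ∧ u d = x := by
  unfold Query.cand
  split_ifs with h
  · rw [mem_children]
    constructor
    · rintro ⟨u, hu, h1, h2⟩
      exact ⟨u, hu, _, rfl, fun j hj => h1 j (Q.lt_depthAt_iff.2 hj), h2⟩
    · rintro ⟨u, hu, d, hd, h1, h2⟩
      have : d = ⟨Q.depthAt a i, h⟩ := Fin.ext hd
      subst this
      exact ⟨u, hu, fun j hj => h1 j (Q.lt_depthAt_iff.1 hj), h2⟩
  · simp only [Finset.notMem_empty, false_iff]
    rintro ⟨u, hu, d, hd, -⟩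
    exact h (hd ▸ d.2)

theorem Query.cand_mono {A B : Str ar} (h : ∀ a, A (Q.rel a) ⊆ B (Q.rel a)) (t : ℕ → ℕ)
    (a : Fin Q.m) (i : ℕ) : Q.cand A t a i ⊆ Q.cand B t a i := by
  intro x hx
  rw [Query.mem_cand] at hx ⊢
  obtain ⟨u, hu, h'⟩ := hx
  exact ⟨u, h a hu, h'⟩

variable (Q) in
/-- The values of `t` for the variables before `v_i` are consistent with every atom that
contains one of these variables. -/
def Query.Consistent (A : Str ar) (i : ℕ) (t : ℕ → ℕ) : Prop :=
  ∀ a, 0 < Q.depthAt a i →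
    ∃ u ∈ A (Q.rel a), ∀ j, (Q.vars a j : ℕ) < i → u j = t (Q.vars a j)

theorem Query.Consistent.succ {A : Str ar} {i : ℕ} {t : ℕ → ℕ} (h : Q.Consistent A i t) {x : ℕ}
    (hx : ∀ a ∈ Q.atomsAt i, x ∈ Q.cand A t a i) :
    Q.Consistent A (i + 1) (Function.update t i x) := by
  intro a ha
  by_cases hm : a ∈ Q.atomsAt i
  · obtain ⟨u, hu, d, hd, h1, h2⟩ := Query.mem_cand.1 (hx a hm)
    refine ⟨u, hu, fun j hj => ?_⟩
    have hdv := Query.vars_depthAt_of_mem hm d hd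
    rcases (Nat.lt_succ_iff_lt_or_eq).1 hj with hj | hj
    · rw [Function.update_of_ne hj.ne, h1 j hj]
    · have : j = d := (Q.vars_strictMono a).injective (Fin.ext (hj.trans hdv.symm))
      rw [hj, Function.update_self, this, h2]
  · rw [Query.depthAt_succ_of_not_mem hm] at ha
    obtain ⟨u, hu, h1⟩ := h a ha
    refine ⟨u, hu, fun j hj => ?_⟩
    rw [Query.vars_lt_succ_iff_of_not_mem hm] at hj
    rw [Function.update_of_ne hj.ne, h1 j hj]

theorem Query.Consistent.mem_result {A : Str ar} {t : ℕ → ℕ} (h : Q.Consistent A k t) :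
    (fun v : Fin k => t v) ∈ Q.result A := by
  intro a
  obtain ⟨u, hu, h1⟩ := h a (lt_of_le_of_lt (Nat.zero_le _)
    (Query.lt_depthAt_iff (j := ⟨0, Q.arity_pos a⟩).2 (Fin.is_lt _)))
  have : u = fun j => t (Q.vars a j) := funext fun j => h1 j (Fin.is_lt _)
  rwa [this] at hu

theorem Query.mem_cand_of_mem_result {A : Str ar} {i : ℕ} (hi : i < k) {t : ℕ → ℕ}
    {s : Fin k → ℕ} (hs : s ∈ Q.result A) (hst : ∀ v : Fin k, (v : ℕ) < i → s v = t v)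
    {a : Fin Q.m} (ha : a ∈ Q.atomsAt i) : s ⟨i, hi⟩ ∈ Q.cand A t a i := by
  obtain ⟨d, hd⟩ := Query.mem_atomsAt.1 ha
  refine Query.mem_cand.2 ⟨_, hs a, d, (Query.depthAt_eq_of_vars_eq hd).symm,
    fun j hj => hst _ hj, ?_⟩
  congr 1
  exact Fin.ext hd

theorem exists_card_filter_lt_eq (S : Finset ℕ) {x : ℕ} (hx : x < S.card) :
    ∃ y ∈ S, (S.filter fun z => z < y).card = x := by
  refine ⟨S.orderEmbOfFin rfl ⟨x, hx⟩, S.orderEmbOfFin_mem rfl _, ?_⟩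
  have : (S.filter fun z => z < S.orderEmbOfFin rfl ⟨x, hx⟩) =
      (Finset.Iio (⟨x, hx⟩ : Fin S.card)).map (S.orderEmbOfFin rfl).toEmbedding := by
    ext z
    simp only [Finset.mem_filter, Finset.mem_map, Finset.mem_Iio]
    constructor
    · rintro ⟨hz, hlt⟩
      obtain ⟨w, rfl⟩ : z ∈ Set.range (S.orderEmbOfFin rfl) := by
        rw [Finset.range_orderEmbOfFin]; exact hz
      exact ⟨w, (S.orderEmbOfFin rfl).lt_iff_lt.1 hlt, rfl⟩
    · rintro ⟨w, hw, rfl⟩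
      exact ⟨S.orderEmbOfFin_mem rfl w, (S.orderEmbOfFin rfl).lt_iff_lt.2 hw⟩
  rw [this, Finset.card_map, Fin.card_Iio]

/-- The ranks of the children of a node fill an initial segment, so each number below their count is
the rank of some child; any tuple through that child is sent to `s`. -/
theorem mem_renumber_of_lt_card {r : ℕ} {R : Finset (Fin r → ℕ)} {d : Fin r} {s : Fin r → ℕ}
    (hs : s d < (children R d s).card) (h0 : ∀ j, d < j → s j = 0) : s ∈ renumber R d := by
  obtain ⟨y, hy, hcard⟩ := exists_card_filter_lt_eq _ hs
  obtain ⟨u, hu, h1, rfl⟩ := mem_children.1 hy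
  refine Finset.mem_image.2 ⟨u, hu, funext fun j => ?_⟩
  rcases lt_trichotomy j d with h | h | h
  · rw [if_pos h, h1 j h]
  · subst h
    rw [if_neg (lt_irrefl _), if_pos rfl, children_congr h1, hcard]
  · rw [if_neg h.not_gt, if_neg h.ne', h0 j h]

variable (Q) in
/-- `B'` arises from `B` by renumbering the relation of every atom at the depth that comes
after the variables before `v_i`, where there is such a depth. -/
def Query.RenumberedAt (i : ℕ) (B B' : Str ar) : Prop :=
  ∀ a, B' (Q.rel a) =
    if h : Q.depthAt a i < ar (Q.rel a) then renumber (B (Q.rel a)) ⟨_, h⟩ else B (Q.rel a)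

/-- The relations are renumbered one at a time. Distinct atoms have distinct symbols, so each step
leaves the relations of the other atoms untouched. -/
theorem ClosedUnderRenumbering.exists_renumberedAt {𝒦 : Set (Str ar)}
    (h𝒦 : ClosedUnderRenumbering 𝒦) {B : Str ar} (hB : B ∈ 𝒦) (i : ℕ) :
    ∃ B' ∈ 𝒦, Q.RenumberedAt i B B' := by
  classical
  have key : ∀ s : Finset (Fin Q.m), ∃ B' ∈ 𝒦, (∀ a ∈ s, B' (Q.rel a) =
      if h : Q.depthAt a i < ar (Q.rel a) then renumber (B (Q.rel a)) ⟨_, h⟩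
      else B (Q.rel a)) ∧ ∀ a ∉ s, B' (Q.rel a) = B (Q.rel a) := by
    intro s
    induction s using Finset.induction_on with
    | empty => exact ⟨B, hB, by simp, fun _ _ => rfl⟩
    | insert b s hb ih =>
      obtain ⟨B', hB', h1, h2⟩ := ih
      by_cases h : Q.depthAt b i < ar (Q.rel b)
      · refine ⟨Function.update B' (Q.rel b) (renumber (B' (Q.rel b)) ⟨_, h⟩),
          h𝒦 B' hB' _ ⟨Q.rel b, ⟨_, h⟩, by simp, fun S hS => by simp [hS]⟩, ?_, ?_⟩
        · intro a ha
          rcases Finset.mem_insert.1 ha with rfl | ha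
          · rw [Function.update_self, dif_pos h, h2 _ hb]
          · have hne : a ≠ b := fun e => hb (e ▸ ha)
            rw [Function.update_of_ne (Q.rel_injective.ne hne), h1 a ha]
        · intro a ha
          rw [Finset.mem_insert, not_or] at ha
          rw [Function.update_of_ne (Q.rel_injective.ne ha.1), h2 a ha.2]
      · refine ⟨B', hB', ?_, fun a ha => h2 a fun h' => ha (Finset.mem_insert_of_mem h')⟩
        intro a ha
        rcases Finset.mem_insert.1 ha with rfl | ha
        · rw [dif_neg h, h2 _ hb]
        · exact h1 a ha
  obtain ⟨B', hB', h, -⟩ := key Finset.univ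
  exact ⟨B', hB', fun a => h a (Finset.mem_univ a)⟩

/-- There are three kinds of atoms. One that contains `v_i` has a child of rank `x`; one whose next
argument comes after `v_i` has a child of rank `0`; one with all arguments before `v_i` is not
renumbered and holds by consistency. -/
theorem Query.RenumberedAt.mem_result {i : ℕ} {B B' : Str ar} (h : Q.RenumberedAt i B B')
    (hB : ∀ a, (B (Q.rel a)).Nonempty) {t : ℕ → ℕ} (ht : Q.Consistent B i t) {x : ℕ}
    (hx : ∀ a ∈ Q.atomsAt i, x < (Q.cand B t a i).card) :
    (fun v : Fin k => if (v : ℕ) < i then t v else if (v : ℕ) = i then x else 0) ∈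
      Q.result B' := by
  intro a
  have hu : ∃ u ∈ B (Q.rel a), ∀ j, (Q.vars a j : ℕ) < i → u j = t (Q.vars a j) := by
    -- Consistency does not constrain an atom without earlier variables; a tuple for it comes from
    -- nonemptiness of the relation.
    rcases Nat.eq_zero_or_pos (Q.depthAt a i) with h0 | h0
    · obtain ⟨u, hu⟩ := hB a
      refine ⟨u, hu, fun j hj => ?_⟩
      have := Q.lt_depthAt_iff.2 hj
      omega
    · exact ht a h0
  rw [h a]
  split_ifs with hd
  · set s : Fin (ar (Q.rel a)) → ℕ := fun j => if (Q.vars a j : ℕ) < i then t (Q.vars a j)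
      else if (Q.vars a j : ℕ) = i then x else 0 with hs
    have hc : children (B (Q.rel a)) ⟨Q.depthAt a i, hd⟩ s = Q.cand B t a i := by
      rw [Query.cand, dif_pos hd]
      refine children_congr fun j hj => ?_
      rw [hs]
      exact if_pos (Q.lt_depthAt_iff.1 hj)
    have hnl : ¬ (Q.vars a ⟨Q.depthAt a i, hd⟩ : ℕ) < i := fun hlt =>
      lt_irrefl _ (Q.lt_depthAt_iff.2 hlt)
    refine mem_renumber_of_lt_card ?_ fun j hj => ?_
    · rw [hc]
      simp only [hs]
      rw [if_neg hnl]
      split_ifs with he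
      · exact hx a (Query.mem_atomsAt.2 ⟨_, he⟩)
      -- The next argument comes after `v_i` and has the value `0`: it suffices that the node has a
      -- child at all.
      · obtain ⟨u, hu, h1⟩ := hu
        exact Finset.card_pos.2 ⟨_, Query.mem_cand.2 ⟨u, hu, ⟨_, hd⟩, rfl, h1, rfl⟩⟩
    · have h1 : (Q.vars a ⟨Q.depthAt a i, hd⟩ : ℕ) < Q.vars a j := Q.vars_strictMono a hj
      simp only [hs]
      rw [if_neg (by omega), if_neg (by omega)]
  · obtain ⟨u, hu, h1⟩ := hu
    convert hu using 1
    funext j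
    have hj : (Q.vars a j : ℕ) < i := Q.lt_depthAt_iff.1 (lt_of_lt_of_le j.2 (not_lt.1 hd))
    exact (if_pos hj).trans (h1 j hj).symm

/-- The number of elements of `N` that agree with `t` on the variables before `v_i`. -/
def agreeing (N : Finset (Fin k → ℕ)) (i : ℕ) (t : ℕ → ℕ) : Finset (Fin k → ℕ) :=
  N.filter fun s => ∀ v : Fin k, (v : ℕ) < i → s v = t v

theorem mem_agreeing {N : Finset (Fin k → ℕ)} {i : ℕ} {t : ℕ → ℕ} {s : Fin k → ℕ} :
    s ∈ agreeing N i t ↔ s ∈ N ∧ ∀ v : Fin k, (v : ℕ) < i → s v = t v := by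
  simp [agreeing]

theorem Query.RenumberedAt.exists_card_cand_le {i : ℕ} (hi : i < k) {B B' : Str ar}
    (h : Q.RenumberedAt i B B') (hB : ∀ a, (B (Q.rel a)).Nonempty) {t : ℕ → ℕ}
    (ht : Q.Consistent B i t) :
    ∃ b ∈ Q.atomsAt i,
      (Q.cand B t b i).card ≤ (agreeing (Q.result_finite B').toFinset i t).card := by
  obtain ⟨a, ha⟩ := Query.exists_mem_atomsAt (Q := Q) hi
  obtain ⟨b, hb, hmin⟩ := Finset.exists_min_image (Q.atomsAt i).toFinset
    (fun a => (Q.cand B t a i).card) ⟨a, List.mem_toFinset.2 ha⟩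
  refine ⟨b, List.mem_toFinset.1 hb, ?_⟩
  rw [← Finset.card_range (Q.cand B t b i).card]
  refine Finset.card_le_card_of_injOn (fun x => fun v : Fin k =>
    if (v : ℕ) < i then t v else if (v : ℕ) = i then x else 0) (fun x hx => ?_) ?_
  · rw [Finset.mem_coe, mem_agreeing, Set.Finite.mem_toFinset]
    refine ⟨h.mem_result hB ht fun a ha => ?_, fun v hv => if_pos hv⟩
    exact lt_of_lt_of_le (Finset.mem_range.1 hx) (hmin a (List.mem_toFinset.2 ha))
  · intro x _ y _ hxy
    simpa using congrFun hxy ⟨i, hi⟩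

/-- The sets on the left are disjoint because an element determines `x` as its value at `v_i`. This
is what lets the costs of sibling nodes add up without loss. -/
theorem sum_card_agreeing_le {i : ℕ} (hi : i < k) (N : Finset (Fin k → ℕ)) (t : ℕ → ℕ)
    (S : Finset ℕ) :
    ∑ x ∈ S, (agreeing N (i + 1) (Function.update t i x)).card ≤ (agreeing N i t).card := by
  classical
  rw [← Finset.card_biUnion]
  · refine Finset.card_le_card fun s hs => ?_
    obtain ⟨x, -, hs⟩ := Finset.mem_biUnion.1 hs
    rw [mem_agreeing] at hs ⊢
    refine ⟨hs.1, fun v hv => ?_⟩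
    rw [hs.2 v (by omega), Function.update_of_ne hv.ne]
  · intro x _ y _ hxy
    refine Finset.disjoint_left.2 fun s hs hs' => hxy ?_
    have h1 := (mem_agreeing.1 hs).2 ⟨i, hi⟩ (Nat.lt_succ_self i)
    have h2 := (mem_agreeing.1 hs').2 ⟨i, hi⟩ (Nat.lt_succ_self i)
    simpa using h1.symm.trans h2

/-- A bound for the number of steps between the visit of the node `t 0, …, t (i - 1)` and the
return from it, if at most `(N j).card` sibling keys matter for the variable `v_j`. -/
def stepBound (m : ℕ) (N : ℕ → Finset (Fin k → ℕ)) (i : ℕ) (t : ℕ → ℕ) : ℕ :=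
  10 + ∑ j ∈ Finset.Ico i k, (4 * m + 10) * (agreeing (N j) i t).card

/-- Of the factor `4 * m + 10` at level `i`, the part `4 * m` pays for the moves of the join, and
the `10` pays for the additive constant in the bound of each child node. -/
theorem stepBound_rec {i : ℕ} (hi : i < k) (m : ℕ) (N : ℕ → Finset (Fin k → ℕ)) (t : ℕ → ℕ)
    (S : Finset ℕ) (hS : S.card ≤ (agreeing (N i) i t).card) :
    4 * (m * (agreeing (N i) i t).card) + ∑ x ∈ S, stepBound m N (i + 1) (Function.update t i x)
      + 10 ≤ stepBound m N i t := by
  unfold stepBound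
  rw [Finset.sum_add_distrib, Finset.sum_comm, Finset.sum_eq_sum_Ico_succ_bot hi]
  have : ∑ j ∈ Finset.Ico (i + 1) k, ∑ x ∈ S,
      (4 * m + 10) * (agreeing (N j) (i + 1) (Function.update t i x)).card ≤
      ∑ j ∈ Finset.Ico (i + 1) k, (4 * m + 10) * (agreeing (N j) i t).card := by
    refine Finset.sum_le_sum fun j _ => ?_
    rw [← Finset.mul_sum]
    exact Nat.mul_le_mul_left _ (sum_card_agreeing_le hi _ _ _)
  simp only [Finset.sum_const, smul_eq_mul]
  nlinarith

end Counting

/-! ### Trie iterators relative to a node of the search. -/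

section Iterators

variable {σ : Type*} {ar : σ → ℕ} {k : ℕ} (Q : Query ar k)

/-- The iterator for the atom `a` stands at the node given by the values of `t` for the
variables before `v_i`. -/
structure Query.AtNode (t : ℕ → ℕ) (i : ℕ) (a : Fin Q.m) (it : TrieIter (ar (Q.rel a))) :
    Prop where
  depth : it.depth = Q.depthAt a i
  keys : ∀ j, (Q.vars a j : ℕ) < i → it.keys j = t (Q.vars a j)
  atEnd : it.atEnd = false

/-- The iterator for the atom `a` stands among the children of the node given by the values of
`t` for the variables before `v_i`, or behind them. -/
structure Query.BelowNode (t : ℕ → ℕ) (i : ℕ) (a : Fin Q.m) (it : TrieIter (ar (Q.rel a))) :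
    Prop where
  depth : it.depth = Q.depthAt a i + 1
  keys : ∀ j, (Q.vars a j : ℕ) < i → it.keys j = t (Q.vars a j)

/-- The iterator for the atom `a` stands at the least key that is at least `lb` among the
children of the node given by the values of `t` for the variables before `v_i`. -/
structure Query.MovedTo (A : Str ar) (t : ℕ → ℕ) (i : ℕ) (a : Fin Q.m) (lb : ℕ)
    (it : TrieIter (ar (Q.rel a))) : Prop extends Q.BelowNode t i a it where
  of_atEnd : it.atEnd = true → ∀ y ∈ Q.cand A t a i, y < lb
  key_mem : it.atEnd = false → it.key ∈ Q.cand A t a i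
  le_key : it.atEnd = false → lb ≤ it.key
  key_le : it.atEnd = false → ∀ y ∈ Q.cand A t a i, lb ≤ y → it.key ≤ y

variable {Q} {A : Str ar} {t : ℕ → ℕ} {i : ℕ} {a : Fin Q.m} {it : TrieIter (ar (Q.rel a))}

theorem TrieIter.key_eq {r : ℕ} {it : TrieIter r} {d : Fin r} (h : it.depth = d + 1) :
    it.key = it.keys d := by
  unfold TrieIter.key
  rw [h]
  simp

theorem Query.movedTo_place (hd : Q.depthAt a i < ar (Q.rel a)) {keys : Fin (ar (Q.rel a)) → ℕ}
    (hkeys : ∀ j, (Q.vars a j : ℕ) < i → keys j = t (Q.vars a j)) (lb : ℕ) :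
    Q.MovedTo A t i a lb (TrieIter.place (A (Q.rel a)) keys ⟨Q.depthAt a i, hd⟩ lb) := by
  have hc : children (A (Q.rel a)) ⟨Q.depthAt a i, hd⟩ keys = Q.cand A t a i := by
    rw [Query.cand, dif_pos hd]
    exact children_congr fun j hj => hkeys j (Q.lt_depthAt_iff.1 hj)
  unfold TrieIter.place
  rw [hc]
  split_ifs with h
  · have hkey : ∀ y, TrieIter.key (⟨Q.depthAt a i + 1,
        Function.update keys ⟨Q.depthAt a i, hd⟩ y, false⟩ : TrieIter (ar (Q.rel a))) = y := by
      intro y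
      rw [TrieIter.key_eq (d := ⟨Q.depthAt a i, hd⟩) rfl]
      simp
    have hm := Finset.mem_filter.1 (Finset.min'_mem _ h)
    refine ⟨⟨rfl, fun j hj => ?_⟩, by simp, fun _ => ?_, fun _ => ?_, fun _ y hy hlb => ?_⟩
    · have : j ≠ ⟨Q.depthAt a i, hd⟩ := fun e => by
        have := Q.lt_depthAt_iff.2 hj
        rw [e] at this
        exact lt_irrefl _ this
      simp only [Function.update_of_ne this]
      exact hkeys j hj
    · rw [hkey]; exact hm.1
    · rw [hkey]; exact hm.2
    · rw [hkey]; exact Finset.min'_le _ _ (Finset.mem_filter.2 ⟨hy, hlb⟩)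
  · refine ⟨⟨rfl, hkeys⟩, fun _ y hy => ?_, by simp, by simp, by simp⟩
    by_contra hn
    exact h ⟨y, Finset.mem_filter.2 ⟨hy, not_lt.1 hn⟩⟩

theorem Query.AtNode.down (h : Q.AtNode t i a it) (ha : a ∈ Q.atomsAt i) :
    Q.MovedTo A t i a 0 (it.down (A (Q.rel a))) := by
  obtain ⟨depth, keys, atEnd⟩ := it
  obtain ⟨h1, h2, h3⟩ := h
  simp only at h1
  subst h1
  rw [TrieIter.down, dif_pos (Query.depthAt_lt_of_mem ha)]
  exact Query.movedTo_place _ h2 0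

theorem Query.BelowNode.seek (h : Q.BelowNode t i a it) (ha : a ∈ Q.atomsAt i) (lb : ℕ) :
    Q.MovedTo A t i a lb (it.seek (A (Q.rel a)) lb) := by
  obtain ⟨depth, keys, atEnd⟩ := it
  obtain ⟨h1, h2⟩ := h
  simp only at h1
  subst h1
  simp only [TrieIter.seek]
  rw [dif_pos (Query.depthAt_lt_of_mem ha)]
  exact Query.movedTo_place _ h2 lb

theorem Query.BelowNode.up (h : Q.BelowNode t i a it) : Q.AtNode t i a it.up :=
  ⟨by simp [TrieIter.up, h.depth], h.keys, rfl⟩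

theorem Query.BelowNode.atNode_succ (h : Q.BelowNode t i a it) (ha : a ∈ Q.atomsAt i)
    (hend : it.atEnd = false) {x : ℕ} (hx : it.key = x) :
    Q.AtNode (Function.update t i x) (i + 1) a it := by
  refine ⟨by rw [h.depth, Query.depthAt_succ_of_mem ha], fun j hj => ?_, hend⟩
  rcases Nat.lt_succ_iff_lt_or_eq.1 hj with hj | hj
  · rw [h.keys j hj, Function.update_of_ne hj.ne]
  · rw [hj, Function.update_self, ← hx, TrieIter.key_eq]
    rw [h.depth, Query.depthAt_eq_of_vars_eq hj]

theorem Query.AtNode.belowNode {x : ℕ} (h : Q.AtNode (Function.update t i x) (i + 1) a it)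
    (ha : a ∈ Q.atomsAt i) : Q.BelowNode t i a it ∧ it.key = x := by
  have hd := h.depth
  rw [Query.depthAt_succ_of_mem ha] at hd
  refine ⟨⟨hd, fun j hj => ?_⟩, ?_⟩
  · rw [h.keys j (by omega), Function.update_of_ne hj.ne]
  · obtain ⟨j, hj⟩ := Query.mem_atomsAt.1 ha
    rw [Query.depthAt_eq_of_vars_eq hj] at hd
    rw [TrieIter.key_eq hd, h.keys j (by omega), hj, Function.update_self]

theorem Query.atNode_succ_iff (ha : a ∉ Q.atomsAt i) (x : ℕ) :
    Q.AtNode (Function.update t i x) (i + 1) a it ↔ Q.AtNode t i a it := by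
  have key : ∀ j, (Q.vars a j : ℕ) < i →
      Function.update t i x (Q.vars a j) = t (Q.vars a j) :=
    fun j hj => Function.update_of_ne hj.ne _ _
  constructor
  · rintro ⟨h1, h2, h3⟩
    exact ⟨by rw [h1, Query.depthAt_succ_of_not_mem ha], fun j hj => by
      rw [h2 j (by omega), key j hj], h3⟩
  · rintro ⟨h1, h2, h3⟩
    refine ⟨by rw [h1, Query.depthAt_succ_of_not_mem ha], fun j hj => ?_, h3⟩
    rw [Query.vars_lt_succ_iff_of_not_mem ha] at hj
    rw [h2 j hj, key j hj]

end Iterators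

/-! ### Invariants of the machine, pieces of the output, and the potential. -/

section Run

variable {σ : Type*} {ar : σ → ℕ} {k : ℕ} {Q : Query ar k} {A : Str ar} {τ : IterTime Q}
  {t : ℕ → ℕ} {i : ℕ} {c c' : Config Q}

/-- The machine is at the node `t 0, …, t (i - 1)` of the trie presented by the triejoin. -/
structure AtPrefix (t : ℕ → ℕ) (i : ℕ) (c : Config Q) : Prop where
  level : c.level = i
  perm : ∀ j, (c.join j).iters.Perm (Q.atomsAt j)
  key : ∀ j, j < i → (c.join j).key = t j
  iter : ∀ a, Q.AtNode t i a (c.iter a)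

/-- The machine has opened the variable `v_i` below the node `t 0, …, t (i - 1)`. -/
structure Opened (t : ℕ → ℕ) (i : ℕ) (c : Config Q) : Prop where
  level : c.level = i + 1
  perm : ∀ j, (c.join j).iters.Perm (Q.atomsAt j)
  key : ∀ j, j < i → (c.join j).key = t j
  iter_of_not_mem : ∀ a, a ∉ Q.atomsAt i → Q.AtNode t i a (c.iter a)
  iter_of_mem : ∀ a ∈ Q.atomsAt i, Q.BelowNode t i a (c.iter a)

/-- The array of iterators of the leapfrog join for `v_i`, read from the index `p` on. -/
def rotated (c : Config Q) (i : ℕ) : List (Fin Q.m) :=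
  (c.join i).iters.rotate (c.join i).p

/-- The invariant of the leapfrog join for `v_i`. -/
structure Leapfrogging (A : Str ar) (t : ℕ → ℕ) (i : ℕ) (c : Config Q) : Prop
    extends Opened t i c where
  iter_atEnd : ∀ a ∈ Q.atomsAt i, (c.iter a).atEnd = false
  key_mem : ∀ a ∈ Q.atomsAt i, (c.iter a).key ∈ Q.cand A t a i
  atEnd : (c.join i).atEnd = false
  p_lt : (c.join i).p < (c.join i).iters.length
  sorted : (rotated c i).Pairwise fun a b => (c.iter a).key ≤ (c.iter b).key

theorem Opened.perm_rotated (h : Opened t i c) : (rotated c i).Perm (Q.atomsAt i) :=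
  (List.rotate_perm _ _).trans (h.perm i)

theorem Opened.of_iter_eq (h : Opened t i c) (hlevel : c'.level = c.level)
    (hjoin : ∀ j, j ≠ i → c'.join j = c.join j)
    (hiters : (c'.join i).iters = (c.join i).iters) (hiter : c'.iter = c.iter) :
    Opened t i c' := by
  refine ⟨hlevel.trans h.level, fun j => ?_, fun j hj => ?_, ?_, ?_⟩
  · by_cases hj : j = i
    · subst hj; rw [hiters]; exact h.perm j
    · rw [hjoin j hj]; exact h.perm j
  · rw [hjoin j hj.ne]; exact h.key j hj
  · rw [hiter]; exact h.iter_of_not_mem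
  · rw [hiter]; exact h.iter_of_mem

theorem Opened.update (h : Opened t i c) (hlevel : c'.level = c.level)
    (hjoin : ∀ j, j ≠ i → c'.join j = c.join j)
    (hiters : (c'.join i).iters = (c.join i).iters) {a : Fin Q.m} (ha : a ∈ Q.atomsAt i)
    {it : TrieIter (ar (Q.rel a))} (hit : Q.BelowNode t i a it)
    (hiter : c'.iter = Function.update c.iter a it) : Opened t i c' := by
  refine ⟨hlevel.trans h.level, fun j => ?_, fun j hj => ?_, fun b hb => ?_, fun b hb => ?_⟩
  · by_cases hj : j = i
    · subst hj; rw [hiters]; exact h.perm j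
    · rw [hjoin j hj]; exact h.perm j
  · rw [hjoin j hj.ne]; exact h.key j hj
  · have : b ≠ a := fun e => hb (e ▸ ha)
    rw [hiter, Function.update_of_ne this]
    exact h.iter_of_not_mem b hb
  · rw [hiter]
    by_cases hba : b = a
    · subst hba; rw [Function.update_self]; exact hit
    · rw [Function.update_of_ne hba]; exact h.iter_of_mem b hb

theorem Leapfrogging.of_iter_eq (h : Leapfrogging A t i c) (hlevel : c'.level = c.level)
    (hjoin : ∀ j, j ≠ i → c'.join j = c.join j)
    (hiters : (c'.join i).iters = (c.join i).iters) (hp : (c'.join i).p = (c.join i).p)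
    (hend : (c'.join i).atEnd = (c.join i).atEnd) (hiter : c'.iter = c.iter) :
    Leapfrogging A t i c' where
  toOpened := h.toOpened.of_iter_eq hlevel hjoin hiters hiter
  iter_atEnd := by rw [hiter]; exact h.iter_atEnd
  key_mem := by rw [hiter]; exact h.key_mem
  atEnd := hend.trans h.atEnd
  p_lt := by rw [hp, hiters]; exact h.p_lt
  sorted := by rw [rotated, hiters, hp, hiter]; exact h.sorted

/-- Moving the iterator at the index `p` forward, beyond all others, and increasing `p`. -/
theorem Leapfrogging.move (h : Leapfrogging A t i c) {a : Fin Q.m} {l : List (Fin Q.m)}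
    (hrot : rotated c i = a :: l) {lb : ℕ} (hlb : ∀ b ∈ Q.atomsAt i, (c.iter b).key ≤ lb)
    {it : TrieIter (ar (Q.rel a))} (hit : Q.MovedTo A t i a lb it) (hend : it.atEnd = false)
    (hlevel : c'.level = c.level) (hjoin : ∀ j, j ≠ i → c'.join j = c.join j)
    (hiters : (c'.join i).iters = (c.join i).iters)
    (hp : (c'.join i).p = ((c.join i).p + 1) % (c.join i).iters.length)
    (hend' : (c'.join i).atEnd = (c.join i).atEnd)
    (hiter : c'.iter = Function.update c.iter a it) :
    Leapfrogging A t i c' ∧ rotated c' i = l ++ [a] ∧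
      ∀ b ∈ Q.atomsAt i, (c'.iter b).key ≤ it.key := by
  have hperm := h.perm_rotated
  have hnd : (a :: l).Nodup := hrot ▸ hperm.nodup_iff.2 (Query.nodup_atomsAt i)
  have hmem : ∀ b, b ∈ a :: l ↔ b ∈ Q.atomsAt i := fun b => hrot ▸ hperm.mem_iff
  have ha : a ∈ Q.atomsAt i := (hmem a).1 List.mem_cons_self
  have hal : a ∉ l := (List.nodup_cons.1 hnd).1
  have hkey : ∀ b ∈ Q.atomsAt i, (c'.iter b).key ≤ it.key := by
    intro b hb
    rw [hiter]
    by_cases hba : b = a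
    · subst hba; rw [Function.update_self]
    · rw [Function.update_of_ne hba]
      exact (hlb b hb).trans (hit.le_key hend)
  have hrot' : rotated c' i = l ++ [a] := by
    rw [rotated, hiters, hp, List.rotate_mod, ← List.rotate_rotate]
    change (rotated c i).rotate 1 = _
    rw [hrot]
    simp
  refine ⟨⟨h.toOpened.update hlevel hjoin hiters ha hit.toBelowNode hiter, fun b hb => ?_,
    fun b hb => ?_, hend'.trans h.atEnd, ?_, ?_⟩, hrot', hkey⟩
  · rw [hiter]
    by_cases hba : b = a
    · subst hba; rw [Function.update_self]; exact hend
    · rw [Function.update_of_ne hba]; exact h.iter_atEnd b hb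
  · rw [hiter]
    by_cases hba : b = a
    · subst hba; rw [Function.update_self]; exact hit.key_mem hend
    · rw [Function.update_of_ne hba]; exact h.key_mem b hb
  · rw [hp, hiters]
    exact Nat.mod_lt _ (lt_of_le_of_lt (Nat.zero_le _) h.p_lt)
  · rw [hrot', List.pairwise_append]
    have hs := h.sorted
    rw [hrot, List.pairwise_cons] at hs
    refine ⟨hs.2.imp_of_mem fun {b d} hb hd hbd => ?_, List.pairwise_singleton _ _,
      fun b hb d hd => ?_⟩
    · rw [hiter, Function.update_of_ne (fun e => hal (by rw [← e]; exact hb)),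
        Function.update_of_ne (fun e => hal (by rw [← e]; exact hd))]
      exact hbd
    · rw [List.mem_singleton] at hd
      subst hd
      refine (hkey b ((hmem b).1 (List.mem_cons_of_mem _ hb))).trans ?_
      rw [hiter, Function.update_self]

theorem Leapfrogging.getElem?_p (h : Leapfrogging A t i c) {a : Fin Q.m}
    {l : List (Fin Q.m)} (hrot : rotated c i = a :: l) :
    (c.join i).iters[(c.join i).p]? = some a := by
  rw [← List.head?_rotate h.p_lt]
  change (rotated c i).head? = _
  rw [hrot, List.head?_cons]

/-- The search starts by reading the entry cyclically before `p`. This is the last entry of the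
rotated array, hence one with the greatest key. -/
theorem Leapfrogging.getElem?_pred_p (h : Leapfrogging A t i c) {a : Fin Q.m}
    {l : List (Fin Q.m)} (hrot : rotated c i = l ++ [a]) :
    (c.join i).iters[((c.join i).p + (c.join i).iters.length - 1) %
      (c.join i).iters.length]? = some a := by
  have hp := h.p_lt
  have hlen : (rotated c i).length = (c.join i).iters.length := List.length_rotate _ _
  have hlast : (rotated c i)[(c.join i).iters.length - 1]? = some a := by
    rw [← hlen, hrot]
    simp
  rw [rotated, List.getElem?_rotate (by omega)] at hlast
  rw [← hlast]
  congr 2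
  omega

/-- From `c`, the machine comes back to the node `t 0, …, t (i - 1)` in at most `n` steps and
produces the elements of `P`, each of them once. -/
def Returns (A : Str ar) (τ : IterTime Q) (t : ℕ → ℕ) (i : ℕ) (P : Set (Fin k → ℕ)) (n : ℕ)
    (c : Config Q) : Prop :=
  ∃ N ≤ n, ∃ c' l, (step A τ)^[N] c = c' ∧ c'.pc = .advance ∧ AtPrefix t i c' ∧
    (∀ j, j < i → c'.join j = c.join j) ∧ c'.out = l ++ c.out ∧ l.Nodup ∧ ∀ s, s ∈ l ↔ s ∈ P

theorem Returns.mono {P : Set (Fin k → ℕ)} {n n' : ℕ} (h : Returns A τ t i P n c)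
    (hn : n ≤ n') : Returns A τ t i P n' c := by
  obtain ⟨N, hN, h⟩ := h
  exact ⟨N, hN.trans hn, h⟩

theorem Returns.of_step {P : Set (Fin k → ℕ)} {n : ℕ} (hs : step A τ c = c')
    (hjoin : ∀ j, j < i → c'.join j = c.join j) (hout : c'.out = c.out)
    (h : Returns A τ t i P n c') : Returns A τ t i P (n + 1) c := by
  obtain ⟨N, hN, c'', l, h1, h2, h3, h4, h5, h6⟩ := h
  refine ⟨N + 1, by omega, c'', l, ?_, h2, h3, fun j hj => (h4 j hj).trans (hjoin j hj),
    hout ▸ h5, h6⟩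
  rw [Function.iterate_succ_apply, hs, h1]

/-- The two steps are `test` and `ascend`. -/
theorem Opened.returns (h : Opened t i c) (hpc : c.pc = .test) (hend : (c.join i).atEnd = true) :
    Returns A τ t i ∅ 2 c := by
  have hl := h.level
  have hs : step A τ c = { c with pc := .ascend, time := c.time + 1 } := by
    simp [step, hpc, hl, hend]
  refine Returns.of_step hs (fun _ _ => rfl) rfl
    ⟨1, le_rfl, _, [], rfl, ?_, ⟨?_, ?_, ?_, ?_⟩, ?_, ?_, List.nodup_nil, by simp⟩
  · simp [step]
  · simp [step, hl]
  · simpa [step] using h.perm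
  · simpa [step] using h.key
  · intro a
    simp only [Function.iterate_one, step, hl, Nat.add_sub_cancel]
    split_ifs with ha
    · exact (h.iter_of_mem a ha).up
    · exact h.iter_of_not_mem a ha
  · simp [step]
  · simp [step]

/-- The elements of the query result that extend `t 0, …, t (i - 1)`. -/
def Query.extensions (Q : Query ar k) (A : Str ar) (t : ℕ → ℕ) (i : ℕ) : Set (Fin k → ℕ) :=
  {s | s ∈ Q.result A ∧ ∀ v : Fin k, (v : ℕ) < i → s v = t v}

/-- The elements of the query result that extend `t 0, …, t (i - 1)` and have a value of at
least `lb` for `v_i`. -/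
def Query.extensionsFrom (Q : Query ar k) (A : Str ar) (t : ℕ → ℕ) (i lb : ℕ) :
    Set (Fin k → ℕ) :=
  {s | s ∈ Q.extensions A t i ∧ ∀ v : Fin k, (v : ℕ) = i → lb ≤ s v}

theorem Query.extensionsFrom_eq_empty (hi : i < k) {a : Fin Q.m} (ha : a ∈ Q.atomsAt i) {lb : ℕ}
    (h : ∀ y ∈ Q.cand A t a i, y < lb) : Q.extensionsFrom A t i lb = ∅ := by
  refine Set.eq_empty_iff_forall_notMem.2 fun s hs => ?_
  have h1 := hs.2 ⟨i, hi⟩ rfl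
  have h2 := h _ (Query.mem_cand_of_mem_result hi hs.1.1 hs.1.2 ha)
  omega

/-- The value of a result at `v_i` is a candidate of every atom containing `v_i`; a gap in the keys
of one atom is thus a gap in the results. -/
theorem Query.extensionsFrom_eq (hi : i < k) {a : Fin Q.m} (ha : a ∈ Q.atomsAt i) {lb lb' : ℕ}
    (hle : lb ≤ lb') (h : ∀ y ∈ Q.cand A t a i, lb ≤ y → lb' ≤ y) :
    Q.extensionsFrom A t i lb = Q.extensionsFrom A t i lb' := by
  ext s
  refine ⟨fun hs => ⟨hs.1, fun v hv => ?_⟩, fun hs => ⟨hs.1, fun v hv => hle.trans (hs.2 v hv)⟩⟩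
  have : v = ⟨i, hi⟩ := Fin.ext hv
  subst this
  exact h _ (Query.mem_cand_of_mem_result hi hs.1.1 hs.1.2 ha) (hs.2 _ rfl)

theorem Query.mem_extensionsFrom_iff_or (hi : i < k) {x : ℕ} {s : Fin k → ℕ} :
    s ∈ Q.extensionsFrom A t i x ↔ s ∈ Q.extensionsFrom A t i (x + 1) ∨
      s ∈ Q.extensions A (Function.update t i x) (i + 1) := by
  have hv : ∀ v : Fin k, (v : ℕ) = i ↔ v = ⟨i, hi⟩ := fun v => by rw [Fin.ext_iff]
  have h1 : (∀ v : Fin k, (v : ℕ) < i + 1 → s v = Function.update t i x v) ↔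
      (∀ v : Fin k, (v : ℕ) < i → s v = t v) ∧ s ⟨i, hi⟩ = x := by
    constructor
    · intro h
      refine ⟨fun v hv => ?_, ?_⟩
      · rw [h v (by omega), Function.update_of_ne hv.ne]
      · rw [h ⟨i, hi⟩ (Nat.lt_succ_self i), Function.update_self]
    · rintro ⟨h, h'⟩ v hlt
      rcases Nat.lt_succ_iff_lt_or_eq.1 hlt with hlt | heq
      · rw [h v hlt, Function.update_of_ne hlt.ne]
      · rw [(hv v).1 heq, h', Function.update_self]
  simp only [Query.extensionsFrom, Query.extensions, Set.mem_ofPred_eq, h1, hv, forall_eq]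
  have : x ≤ s ⟨i, hi⟩ ↔ x + 1 ≤ s ⟨i, hi⟩ ∨ s ⟨i, hi⟩ = x := by omega
  tauto

/-- The number of keys beyond the current one, weighted, and the number of moves until it is
the turn of `b`. -/
def potential (A : Str ar) (t : ℕ → ℕ) (i : ℕ) (b : Fin Q.m) (u : List (Fin Q.m))
    (c : Config Q) : ℕ :=
  Q.m * ((Q.cand A t b i).filter fun y => (c.iter b).key < y).card + u.length + 1

/-- If `b` itself moves, it passes at least one key, which frees `m` units, while its new waiting
time is at most `m - 1`. If another iterator moves, `b` comes one place closer to its turn. -/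
theorem Leapfrogging.exists_potential_lt (h : Leapfrogging A t i c) {a b : Fin Q.m}
    {l u v : List (Fin Q.m)} (hrot : rotated c i = a :: l) (huv : rotated c i = u ++ b :: v)
    {lb : ℕ} (hlb : (c.iter a).key < lb)
    {it : TrieIter (ar (Q.rel a))} (hit : Q.MovedTo A t i a lb it) (hend : it.atEnd = false)
    (hiter : c'.iter = Function.update c.iter a it) :
    ∃ u' v', l ++ [a] = u' ++ b :: v' ∧ potential A t i b u' c' < potential A t i b u c := by
  have hlen : (rotated c i).length ≤ Q.m :=
    h.perm_rotated.length_eq.trans_le (Query.length_atomsAt_le i)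
  have hnd : (a :: l).Nodup := hrot ▸ h.perm_rotated.nodup_iff.2 (Query.nodup_atomsAt i)
  rw [hrot] at huv hlen
  cases u with
  | nil =>
    rw [List.nil_append, List.cons.injEq] at huv
    obtain ⟨rfl, rfl⟩ := huv
    refine ⟨l, [], rfl, ?_⟩
    have hk := hit.le_key hend
    have hlt : ((Q.cand A t a i).filter fun y => (c'.iter a).key < y).card <
        ((Q.cand A t a i).filter fun y => (c.iter a).key < y).card := by
      rw [hiter, Function.update_self]
      refine Finset.card_lt_card (Finset.ssubset_iff_of_subset ?_ |>.2 ⟨it.key, ?_, ?_⟩)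
      · refine Finset.monotone_filter_right _ fun y _ hy => ?_
        exact lt_of_lt_of_le (hlb.trans_le hk) (le_of_lt hy)
      · exact Finset.mem_filter.2 ⟨hit.key_mem hend, hlb.trans_le hk⟩
      · simp
    have := Nat.mul_le_mul_left Q.m (Nat.succ_le_of_lt hlt)
    rw [Nat.mul_succ] at this
    rw [List.length_cons] at hlen
    simp only [potential, List.length_nil]
    omega
  | cons d u =>
    rw [List.cons_append, List.cons.injEq] at huv
    obtain ⟨rfl, rfl⟩ := huv
    refine ⟨u, v ++ [a], by simp, ?_⟩
    have hba : b ≠ a := fun e => (List.nodup_cons.1 hnd).1 (by simp [e])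
    simp only [potential, hiter, Function.update_of_ne hba, List.length_cons]
    omega

theorem Leapfrogging.atPrefix_succ (h : Leapfrogging A t i c) {x : ℕ}
    (hx : ∀ a ∈ Q.atomsAt i, (c.iter a).key = x) (hlevel : c'.level = c.level)
    (hjoin : ∀ j, j ≠ i → c'.join j = c.join j)
    (hiters : (c'.join i).iters = (c.join i).iters) (hkey : (c'.join i).key = x)
    (hiter : c'.iter = c.iter) : AtPrefix (Function.update t i x) (i + 1) c' := by
  have h' := h.toOpened.of_iter_eq hlevel hjoin hiters hiter
  refine ⟨h'.level, h'.perm, fun j hj => ?_, fun a => ?_⟩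
  · rcases Nat.lt_succ_iff_lt_or_eq.1 hj with hj | hj
    · rw [Function.update_of_ne hj.ne, h'.key j hj]
    · rw [hj, Function.update_self, hkey]
  · by_cases ha : a ∈ Q.atomsAt i
    · rw [hiter]
      exact (h.iter_of_mem a ha).atNode_succ ha (h.iter_atEnd a ha) (hx a ha)
    · exact (Query.atNode_succ_iff ha x).2 (h'.iter_of_not_mem a ha)

/-- After the return from a node below, the leapfrog join is as before. -/
theorem Leapfrogging.of_atPrefix_succ (h : Leapfrogging A t i c) {x : ℕ}
    (hx : ∀ a ∈ Q.atomsAt i, (c.iter a).key = x)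
    (hjoin : ∀ j, j < i → c'.join j = c.join j)
    (hiters : (c'.join i).iters = (c.join i).iters) (hp : (c'.join i).p = (c.join i).p)
    (hend : (c'.join i).atEnd = (c.join i).atEnd)
    (h' : AtPrefix (Function.update t i x) (i + 1) c') :
    Leapfrogging A t i c' ∧ ∀ a ∈ Q.atomsAt i, (c'.iter a).key = x := by
  have hb := fun a ha => (h'.iter a).belowNode ha
  refine ⟨⟨⟨h'.level, h'.perm, fun j hj => ?_, fun a ha => ?_, fun a ha => (hb a ha).1⟩,
    fun a ha => (h'.iter a).atEnd, fun a ha => ?_, hend.trans h.atEnd, ?_, ?_⟩,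
    fun a ha => (hb a ha).2⟩
  · rw [hjoin j hj, h.key j hj]
  · exact (Query.atNode_succ_iff ha x).1 (h'.iter a)
  · rw [(hb a ha).2, ← hx a ha]; exact h.key_mem a ha
  · rw [hp, hiters]; exact h.p_lt
  · have hr : rotated c' i = rotated c i := by rw [rotated, hiters, hp, rotated]
    rw [hr]
    -- All keys equal `x` here, so every order of the iterators is sorted.
    refine List.Pairwise.imp_of_mem (R := fun _ _ => True) (fun {a d} ha hd _ => ?_)
      (List.pairwise_of_forall fun _ _ => trivial)
    rw [(hb a (h.perm_rotated.mem_iff.1 ha)).2, (hb d (h.perm_rotated.mem_iff.1 hd)).2]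

end Run

/-! ### Leapfrog search and its cost. -/

section Search

variable {σ : Type*} {ar : σ → ℕ} {k : ℕ} {Q : Query ar k} {A : Str ar} {τ : IterTime Q}
  {t : ℕ → ℕ} {i : ℕ} {c : Config Q}

theorem Leapfrogging.key_le_getLast (h : Leapfrogging A t i c) {z : Fin Q.m}
    {w : List (Fin Q.m)} (hw : rotated c i = w ++ [z]) :
    ∀ a ∈ Q.atomsAt i, (c.iter a).key ≤ (c.iter z).key := by
  intro a ha
  have hs := h.sorted
  rw [hw, List.pairwise_append] at hs
  have ha' : a ∈ rotated c i := h.perm_rotated.mem_iff.2 ha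
  rw [hw, List.mem_append, List.mem_singleton] at ha'
  rcases ha' with ha' | rfl
  · exact hs.2.2 a ha' z (List.mem_singleton.2 rfl)
  · exact le_rfl

theorem Leapfrogging.head_key_le (h : Leapfrogging A t i c) {a : Fin Q.m}
    {l : List (Fin Q.m)} (hrot : rotated c i = a :: l) :
    ∀ b ∈ Q.atomsAt i, (c.iter a).key ≤ (c.iter b).key := by
  intro b hb
  have hs := h.sorted
  rw [hrot, List.pairwise_cons] at hs
  have hb' : b ∈ rotated c i := h.perm_rotated.mem_iff.2 hb
  rw [hrot, List.mem_cons] at hb'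
  rcases hb' with rfl | hb'
  · exact le_rfl
  · exact hs.1 b hb'

theorem Leapfrogging.returns_of_search (h : Leapfrogging A t i c) (hpc : c.pc = .search)
    {z : Fin Q.m} {w : List (Fin Q.m)} (hw : rotated c i = w ++ [z])
    {P : Set (Fin k → ℕ)} {n : ℕ}
    (hloop : ∀ c' : Config Q, c'.pc = .loop → Leapfrogging A t i c' →
      rotated c' i = rotated c i → c'.iter = c.iter →
      (c'.join i).maxKey = (c.iter z).key → Returns A τ t i P n c') :
    Returns A τ t i P (n + 1) c := by
  have hl := h.level
  have hs : step A τ c =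
      { c with
        join := Function.update c.join i { c.join i with maxKey := (c.iter z).key }
        pc := .loop
        time := c.time + 3 } := by
    have := h.getElem?_pred_p hw
    simp [step, hpc, hl, this]
  have hj : ∀ j, j ≠ i → (step A τ c).join j = c.join j := fun j hj => by
    rw [hs]; exact Function.update_of_ne hj _ _
  refine Returns.of_step (c' := step A τ c) rfl (fun j hji => hj j hji.ne) (by rw [hs]) ?_
  refine hloop _ (by rw [hs]) (h.of_iter_eq (by rw [hs]) hj ?_ ?_ ?_ (by rw [hs])) ?_
    (by rw [hs]) ?_ <;> simp [hs, rotated]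

/-- The loop of leapfrog-search, with everything that happens until `v_i` is closed. -/
theorem returns_of_loop (hi : i < k) (hcons : Q.Consistent A i t) {S : Finset ℕ}
    (hS : ∀ x, (∀ a ∈ Q.atomsAt i, x ∈ Q.cand A t a i) → x ∈ S) {W : ℕ → ℕ}
    (hvisit : ∀ x (c : Config Q), c.pc = .visit → AtPrefix (Function.update t i x) (i + 1) c →
      Q.Consistent A (i + 1) (Function.update t i x) →
      Returns A τ (Function.update t i x) (i + 1)
        (Q.extensions A (Function.update t i x) (i + 1)) (W x) c) (b : Fin Q.m) :
    ∀ (Ψ : ℕ) (c : Config Q) (u v : List (Fin Q.m)), c.pc = .loop → Leapfrogging A t i c →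
      rotated c i = u ++ b :: v →
      (∀ a ∈ Q.atomsAt i, (c.iter a).key ≤ (c.join i).maxKey) →
      potential A t i b u c ≤ Ψ →
      Returns A τ t i (Q.extensionsFrom A t i (c.join i).maxKey)
        (4 * Ψ + 2 + ∑ x ∈ S with (c.join i).maxKey ≤ x, W x) c := by
  intro Ψ
  induction Ψ with
  -- Vacuous: the summand `1` makes the potential positive.
  | zero =>
    intro c u v _ _ _ _ hΨ
    simp [potential] at hΨ
  | succ Ψ ih =>
    intro c u v hpc h huv hmax hΨ
    have hl := h.level
    obtain ⟨a, l, hrot⟩ : ∃ a l, rotated c i = a :: l := by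
      rw [huv]; cases u <;> simp
    have ha : a ∈ Q.atomsAt i := h.perm_rotated.mem_iff.1 (by simp [hrot])
    have hget := h.getElem?_p hrot
    by_cases hka : (c.iter a).key = (c.join i).maxKey
    · -- a key is presented
      set x := (c.join i).maxKey with hx
      -- The iterator at `p` has the least key; if that equals the upper bound `maxKey`, all keys
      -- agree.
      have hkeys : ∀ d ∈ Q.atomsAt i, (c.iter d).key = x := fun d hd =>
        le_antisymm (hmax d hd) (hka ▸ h.head_key_le hrot d hd)
      have hxc : ∀ d ∈ Q.atomsAt i, x ∈ Q.cand A t d i := fun d hd =>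
        hkeys d hd ▸ h.key_mem d hd
      let c2 : Config Q :=
        { c with
          join := Function.update c.join i { c.join i with key := x }
          pc := .visit
          time := c.time + 4 + 1 }
      have hs2 : (step A τ)^[2] c = c2 := by
        have hs1 : step A τ c =
            { c with
              join := Function.update c.join i { c.join i with key := x }
              pc := .test
              time := c.time + 4 } := by
          simp [step, hpc, hl, hget, hka, hx]
        have hend := h.atEnd
        rw [Function.iterate_succ_apply, Function.iterate_one, hs1]
        simp [step, hl, hend, c2]
      have hj2 : ∀ j, j ≠ i → c2.join j = c.join j := fun j hj =>
        Function.update_of_ne hj _ _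
      have hat2 : AtPrefix (Function.update t i x) (i + 1) c2 := by
        refine h.atPrefix_succ hkeys rfl hj2 ?_ ?_ rfl <;> simp [c2]
      obtain ⟨N3, hN3, c3, l3, hs3, hpc3, hat3, hj3, hout3, hnd3, hl3⟩ :=
        hvisit x c2 rfl hat2 (hcons.succ hxc)
      have hji : c3.join i = { c.join i with key := x } := by
        rw [hj3 i (Nat.lt_succ_self i)]; simp [c2]
      obtain ⟨h3, hkeys3⟩ := h.of_atPrefix_succ hkeys
        (fun j hj => (hj3 j (by omega)).trans (hj2 j hj.ne)) (by rw [hji]) (by rw [hji])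
        (by rw [hji]) hat3
      have hrot3 : rotated c3 i = a :: l := by rw [rotated, hji]; exact hrot
      have huv3 : rotated c3 i = u ++ b :: v := by rw [hrot3, ← hrot, huv]
      have hb : b ∈ Q.atomsAt i := h.perm_rotated.mem_iff.1 (by simp [huv])
      have hpot3 : potential A t i b u c3 = potential A t i b u c := by
        simp only [potential, hkeys3 b hb, hkeys b hb]
      have hget3 := h3.getElem?_p hrot3
      -- the rest of the join
      have hrest : Returns A τ t i (Q.extensionsFrom A t i (x + 1))
          -- One unit of potential pays for four steps: `loop` and `test` before the visit below,
          -- `advance` and `search` after it. The first two are already spent here.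
          (4 * Ψ + 4 + ∑ y ∈ S with x + 1 ≤ y, W y) c3 := by
        have hit := (h3.iter_of_mem a ha).seek (A := A) ha (x + 1)
        have hnext : (c3.iter a).next (A (Q.rel a)) =
            (c3.iter a).seek (A (Q.rel a)) (x + 1) := by
          rw [TrieIter.next, hkeys3 a ha]
        generalize (c3.iter a).seek (A (Q.rel a)) (x + 1) = it at hit hnext
        have hl3' := h3.level
        by_cases hend : it.atEnd = true
        · have hs4 : step A τ c3 =
              { c3 with
                iter := Function.update c3.iter a it
                join := Function.update c3.join i { c3.join i with atEnd := true }
                pc := .test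
                time := c3.time + 4 + τ c3 a .next } := by
            simp [step, hpc3, hl3', hget3, hnext, hend]
          have hj4 : ∀ j, j ≠ i → (step A τ c3).join j = c3.join j := fun j hj => by
            rw [hs4]; exact Function.update_of_ne hj _ _
          rw [Query.extensionsFrom_eq_empty hi ha (hit.of_atEnd hend)]
          refine (Returns.of_step (c' := step A τ c3) rfl (fun j hj => hj4 j hj.ne)
            (by rw [hs4]) ?_).mono (n := 3) (by omega)
          refine (h3.toOpened.update (by rw [hs4]) hj4 (by simp [hs4]) ha hit.toBelowNode
            (by rw [hs4])).returns (by rw [hs4]) (by simp [hs4])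
        · rw [Bool.not_eq_true] at hend
          have hs4 : step A τ c3 =
              { c3 with
                iter := Function.update c3.iter a it
                join := Function.update c3.join i
                  { c3.join i with p := ((c3.join i).p + 1) % (c3.join i).iters.length }
                pc := .search
                time := c3.time + 4 + τ c3 a .next } := by
            simp [step, hpc3, hl3', hget3, hnext, hend]
          have hj4 : ∀ j, j ≠ i → (step A τ c3).join j = c3.join j := fun j hj => by
            rw [hs4]; exact Function.update_of_ne hj _ _
          have hiter4 : (step A τ c3).iter = Function.update c3.iter a it := by rw [hs4]
          obtain ⟨h4, hrot4, hmax4⟩ := h3.move (c' := step A τ c3) hrot3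
            (fun d hd => (hkeys3 d hd).trans_le (Nat.le_succ x)) hit hend (by rw [hs4]) hj4
            (by simp [hs4]) (by simp [hs4]) (by simp [hs4]) hiter4
          obtain ⟨u', v', huv', hpot'⟩ := h3.exists_potential_lt hrot3 huv3
            ((hkeys3 a ha).trans_lt (Nat.lt_succ_self x)) hit hend hiter4
          have hka4 : ((step A τ c3).iter a).key = it.key := by
            rw [hiter4, Function.update_self]
          have hle := hit.le_key hend
          rw [Query.extensionsFrom_eq hi ha hle (hit.key_le hend)]
          refine (Returns.of_step (c' := step A τ c3) rfl (fun j hj => hj4 j hj.ne)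
            (by rw [hs4]) (h4.returns_of_search (by rw [hs4]) hrot4
            (n := 4 * Ψ + 2 + ∑ y ∈ S with it.key ≤ y, W y) ?_)).mono ?_
          · intro c5 hpc5 h5 hrot5 hiter5 hmax5
            have hmax5' : (c5.join i).maxKey = it.key := hmax5.trans hka4
            have := ih c5 u' v' hpc5 h5 (by rw [hrot5, hrot4, huv'])
              (fun d hd => by rw [hmax5', hiter5]; exact hmax4 d hd)
              (by
                have : potential A t i b u' c5 = potential A t i b u' (step A τ c3) := by
                  simp only [potential, hiter5]
                omega)
            rwa [hmax5'] at this
          · have : ∑ y ∈ S with it.key ≤ y, W y ≤ ∑ y ∈ S with x + 1 ≤ y, W y :=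
              Finset.sum_le_sum_of_subset
                (Finset.monotone_filter_right _ fun y _ hy => hle.trans hy)
            omega
      obtain ⟨N4, hN4, c4, l4, hs4, hpc4, hat4, hj4, hout4, hnd4, hl4⟩ := hrest
      -- The visit below `x` uses up the summand `W x`; what follows only concerns larger keys.
      have hsum : W x + ∑ y ∈ S with x + 1 ≤ y, W y ≤ ∑ y ∈ S with x ≤ y, W y := by
        rw [← Finset.sum_insert (s := {y ∈ S | x + 1 ≤ y}) (a := x) (by simp)]
        refine Finset.sum_le_sum_of_subset fun y hy => ?_
        rw [Finset.mem_insert, Finset.mem_filter] at hy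
        rw [Finset.mem_filter]
        rcases hy with rfl | hy
        · exact ⟨hS _ hxc, le_rfl⟩
        · exact ⟨hy.1, by omega⟩
      refine ⟨N4 + (N3 + 2), by omega, c4, l4 ++ l3, ?_, hpc4, hat4, fun j hj => ?_, ?_, ?_,
        fun s => ?_⟩
      · rw [Function.iterate_add_apply, Function.iterate_add_apply, hs2, hs3, hs4]
      · rw [hj4 j hj, hj3 j (by omega), hj2 j hj.ne]
      · rw [hout4, hout3, List.append_assoc]
      -- The two parts of the output differ at `v_i`: the earlier tuples have the value `x`, the
      -- later ones a larger value.
      · refine List.Nodup.append hnd4 hnd3 fun s hs hs' => ?_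
        have h1 := ((hl4 s).1 hs).2 ⟨i, hi⟩ rfl
        have h2 := ((hl3 s).1 hs').2 ⟨i, hi⟩ (Nat.lt_succ_self i)
        rw [Function.update_self] at h2
        omega
      · rw [List.mem_append, hl4, hl3]
        exact (Query.mem_extensionsFrom_iff_or hi).symm
    · -- the iterator at the index `p` is moved
      have hlt : (c.iter a).key < (c.join i).maxKey := lt_of_le_of_ne (hmax a ha) hka
      set x := (c.join i).maxKey with hx
      have hit := (h.iter_of_mem a ha).seek (A := A) ha x
      obtain ⟨it, hseek⟩ : ∃ it, (c.iter a).seek (A (Q.rel a)) x = it := ⟨_, rfl⟩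
      rw [hseek] at hit
      by_cases hend : it.atEnd = true
      · have hs4 : step A τ c =
            { c with
              iter := Function.update c.iter a it
              join := Function.update c.join i { c.join i with atEnd := true }
              pc := .test
              time := c.time + 5 + τ c a .seek } := by
          simp [step, hpc, hl, hget, ← hx, hka, hseek, hend]
        have hj4 : ∀ j, j ≠ i → (step A τ c).join j = c.join j := fun j hj => by
          rw [hs4]; exact Function.update_of_ne hj _ _
        rw [Query.extensionsFrom_eq_empty hi ha (hit.of_atEnd hend)]
        refine (Returns.of_step (c' := step A τ c) rfl (fun j hj => hj4 j hj.ne)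
          (by rw [hs4]) ?_).mono (n := 3) (by omega)
        exact (h.toOpened.update (by rw [hs4]) hj4 (by simp [hs4]) ha hit.toBelowNode
          (by rw [hs4])).returns (by rw [hs4]) (by simp [hs4])
      · rw [Bool.not_eq_true] at hend
        have hs4 : step A τ c =
            { c with
              iter := Function.update c.iter a it
              join := Function.update c.join i
                { c.join i with
                  maxKey := it.key
                  p := ((c.join i).p + 1) % (c.join i).iters.length }
              pc := .loop
              time := c.time + 7 + τ c a .seek } := by
          simp [step, hpc, hl, hget, ← hx, hka, hseek, hend]
        have hj4 : ∀ j, j ≠ i → (step A τ c).join j = c.join j := fun j hj => by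
          rw [hs4]; exact Function.update_of_ne hj _ _
        have hiter4 : (step A τ c).iter = Function.update c.iter a it := by rw [hs4]
        obtain ⟨h4, hrot4, hmax4⟩ := h.move (c' := step A τ c) hrot hmax hit hend
          (by rw [hs4]) hj4 (by simp [hs4]) (by simp [hs4]) (by simp [hs4]) hiter4
        obtain ⟨u', v', huv', hpot'⟩ := h.exists_potential_lt hrot huv hlt hit hend hiter4
        have hle := hit.le_key hend
        have hmax5 : ((step A τ c).join i).maxKey = it.key := by simp [hs4]
        rw [Query.extensionsFrom_eq hi ha hle (hit.key_le hend)]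
        have := ih (step A τ c) u' v' (by rw [hs4]) h4 (by rw [hrot4, huv'])
          (fun d hd => by rw [hmax5]; exact hmax4 d hd) (by omega)
        rw [hmax5] at this
        refine (Returns.of_step (c' := step A τ c) rfl (fun j hj => hj4 j hj.ne)
          (by rw [hs4]) this).mono ?_
        have : ∑ y ∈ S with it.key ≤ y, W y ≤ ∑ y ∈ S with x ≤ y, W y :=
          Finset.sum_le_sum_of_subset
            (Finset.monotone_filter_right _ fun y _ hy => hle.trans hy)
        omega

end Search

/-! ### Recursion over the variables: correctness and number of steps. -/

section Visit

variable {σ : Type*} {ar : σ → ℕ} {k : ℕ} {Q : Query ar k} {A : Str ar} {τ : IterTime Q}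

theorem returns_of_visit_of_level_eq {t : ℕ → ℕ} {c : Config Q} (hpc : c.pc = .visit)
    (h : AtPrefix t k c) (hcons : Q.Consistent A k t) :
    Returns A τ t k (Q.extensions A t k) 1 c := by
  have hl := h.level
  have hs : step A τ c =
      { c with
        out := (fun v => (c.join v).key) :: c.out
        pc := .advance
        time := c.time + (k + 2) } := by
    simp [step, hpc, hl]
  have ht : (fun v : Fin k => (c.join v).key) = fun v : Fin k => t v :=
    funext fun v => h.key v v.2
  refine ⟨1, le_rfl, step A τ c, [fun v : Fin k => t v], rfl, by rw [hs], ?_, by simp [hs], ?_,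
    List.nodup_singleton _, fun s => ?_⟩
  · rw [hs]
    exact ⟨h.level, h.perm, h.key, h.iter⟩
  · rw [hs, ← ht]; rfl
  · rw [List.mem_singleton]
    constructor
    · rintro rfl
      exact ⟨hcons.mem_result, fun _ _ => rfl⟩
    · exact fun hs => funext fun v => hs.2 v v.2

theorem exists_descend {t : ℕ → ℕ} {i : ℕ} (hi : i < k) {c : Config Q} (hpc : c.pc = .visit)
    (h : AtPrefix t i c) : ∃ c' : Config Q, (step A τ)^[2] c = c' ∧ c'.pc = .init ∧
      c'.join = c.join ∧ c'.out = c.out ∧ Opened t i c' ∧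
      ∀ a ∈ Q.atomsAt i, Q.MovedTo A t i a 0 (c'.iter a) := by
  have hl := h.level
  have hs : step A τ c = { c with pc := .descend, time := c.time + 1 } := by
    simp [step, hpc, hl, hi.ne]
  rw [Function.iterate_succ_apply, Function.iterate_one, hs]
  refine ⟨_, rfl, rfl, rfl, rfl, ⟨by simp [step, hl], h.perm, h.key, fun a ha => ?_,
    fun a ha => ?_⟩, fun a ha => ?_⟩
  · simp only [step, hl, if_neg ha]
    exact h.iter a
  · simp only [step, hl, if_pos ha]
    exact ((h.iter a).down (A := A) ha).toBelowNode
  · simp only [step, hl, if_pos ha]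
    exact (h.iter a).down ha

/-- Induction on the number `n` of unbound variables. The atom `b` given by `hN` serves as the
reference iterator of the potential, so that the join is charged to elements of `N i` extending `t`.
-/
theorem returns_of_visit {N : ℕ → Finset (Fin k → ℕ)}
    (hN : ∀ i < k, ∀ t, Q.Consistent A i t →
      ∃ b ∈ Q.atomsAt i, (Q.cand A t b i).card ≤ (agreeing (N i) i t).card) :
    ∀ (n i : ℕ), i + n = k → ∀ (t : ℕ → ℕ) (c : Config Q), c.pc = .visit → AtPrefix t i c →
      Q.Consistent A i t → Returns A τ t i (Q.extensions A t i) (stepBound Q.m N i t) c := by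
  intro n
  induction n with
  | zero =>
    intro i hik t c hpc h hcons
    obtain rfl : i = k := hik
    exact (returns_of_visit_of_level_eq hpc h hcons).mono (by unfold stepBound; omega)
  | succ n ih =>
    intro i hik t c hpc h hcons
    have hi : i < k := by omega
    obtain ⟨c2, hs2, hpc2, hjoin2, hout2, h2, hmoved⟩ :=
      exists_descend (A := A) (τ := τ) hi hpc h
    have hl2 := h2.level
    obtain ⟨b, hb, hcard⟩ := hN i hi t hcons
    -- Only keys common to all atoms lead to a visit below. There are at most as many of them as
    -- candidates of `b`.
    set S := (Q.cand A t b i).filter fun x => ∀ a ∈ Q.atomsAt i, x ∈ Q.cand A t a i with hSdef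
    have hS : S.card ≤ (agreeing (N i) i t).card := (Finset.card_filter_le _ _).trans hcard
    have hbound := stepBound_rec hi Q.m N t S hS
    have hfrom : Q.extensionsFrom A t i 0 = Q.extensions A t i := by
      ext s; simp [Query.extensionsFrom]
    suffices hsuff : Returns A τ t i (Q.extensions A t i) (stepBound Q.m N i t - 2) c2 by
      rw [Function.iterate_succ_apply, Function.iterate_one] at hs2
      obtain ⟨M, hM, c', l, h1, h2, h3, h4, h5, h6⟩ := hsuff
      refine ⟨M + 2, by omega, c', l, ?_, h2, h3, fun j hj => ?_, hout2 ▸ h5, h6⟩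
      · rw [Function.iterate_add_apply, Function.iterate_succ_apply, Function.iterate_one, hs2,
          h1]
      · rw [h4 j hj, hjoin2]
    by_cases hany : ((c2.join i).iters.any fun a => (c2.iter a).atEnd) = true
    · obtain ⟨a, ha, hend⟩ := List.any_eq_true.1 hany
      replace ha := (h2.perm i).mem_iff.1 ha
      have hs3 : step A τ c2 =
          { c2 with
            join := Function.update c2.join i { c2.join i with atEnd := true }
            pc := .test
            time := c2.time + ((c2.join i).iters.length + 2) } := by
        simp only [step, hpc2, hl2, Nat.add_sub_cancel, hany, if_true]
      have hj3 : ∀ j, j ≠ i → (step A τ c2).join j = c2.join j := fun j hj => by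
        rw [hs3]; exact Function.update_of_ne hj _ _
      rw [← hfrom, Query.extensionsFrom_eq_empty hi ha ((hmoved a ha).of_atEnd hend)]
      refine (Returns.of_step (c' := step A τ c2) rfl (fun j hj => hj3 j hj.ne) (by rw [hs3])
        ?_).mono (n := 3) (by omega)
      exact (h2.of_iter_eq (by rw [hs3]) hj3 (by simp [hs3]) (by rw [hs3])).returns
        (by rw [hs3]) (by simp [hs3])
    · have hend : ∀ a ∈ Q.atomsAt i, (c2.iter a).atEnd = false := by
        intro a ha
        by_contra hne
        exact hany (List.any_eq_true.2 ⟨a, (h2.perm i).mem_iff.2 ha, by simpa using hne⟩)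
      set r : Fin Q.m → Fin Q.m → Prop := fun a b => (c2.iter a).key ≤ (c2.iter b).key with hr
      have hs3 : step A τ c2 =
          { c2 with
            join := Function.update c2.join i
              { c2.join i with
                iters := (c2.join i).iters.insertionSort r
                p := 0
                atEnd := false }
            pc := .search
            time := c2.time + ((c2.join i).iters.length + 3 + (c2.join i).iters.length ^ 2) } := by
        simp only [step, hpc2, hl2, Nat.add_sub_cancel]
        rw [if_neg hany]
      have hj3 : ∀ j, j ≠ i → (step A τ c2).join j = c2.join j := fun j hj => by
        rw [hs3]; exact Function.update_of_ne hj _ _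
      have hiter3 : (step A τ c2).iter = c2.iter := by rw [hs3]
      have hperm3 : ((c2.join i).iters.insertionSort r).Perm (Q.atomsAt i) :=
        (List.perm_insertionSort r _).trans (h2.perm i)
      have hrot3 : rotated (step A τ c2) i = (c2.join i).iters.insertionSort r := by
        simp [rotated, hs3]
      have hbr : b ∈ rotated (step A τ c2) i := by
        rw [hrot3]; exact hperm3.mem_iff.2 hb
      have h3 : Leapfrogging A t i (step A τ c2) := by
        refine ⟨⟨by rw [hs3]; exact hl2, fun j => ?_, fun j hj => ?_, ?_, ?_⟩, ?_, ?_, ?_, ?_, ?_⟩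
        · by_cases hj : j = i
          · subst hj; simpa [hs3] using hperm3
          · rw [hj3 j hj]; exact h2.perm j
        · rw [hj3 j hj.ne]; exact h2.key j hj
        · rw [hiter3]; exact h2.iter_of_not_mem
        · rw [hiter3]; exact h2.iter_of_mem
        · rw [hiter3]; exact hend
        · rw [hiter3]; exact fun a ha => (hmoved a ha).key_mem (hend a ha)
        · simp [hs3]
        · have := List.length_pos_of_mem hbr
          rw [rotated, List.length_rotate] at this
          simpa [hs3] using this
        · have : IsTrans (Fin Q.m) r := ⟨fun _ _ _ h h' => le_trans h h'⟩
          have : Std.Total r := ⟨fun _ _ => le_total _ _⟩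
          rw [hrot3, hiter3]
          exact List.pairwise_insertionSort r _
      obtain ⟨u, v, huv⟩ := List.append_of_mem hbr
      obtain ⟨w, z, hw⟩ : ∃ w z, rotated (step A τ c2) i = w ++ [z] :=
        ⟨_, _, (List.dropLast_append_getLast (List.ne_nil_of_mem hbr)).symm⟩
      have hz : z ∈ Q.atomsAt i := h3.perm_rotated.mem_iff.1 (by simp [hw])
      have hmz := hmoved z hz
      -- The current key of `b` is itself a candidate but not beyond the current one; the `m` units
      -- it leaves free cover `u.length + 1`.
      have hpot : potential A t i b u (step A τ c2) ≤
          Q.m * (agreeing (N i) i t).card := by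
        have hlen : u.length + 1 ≤ Q.m := by
          have h1 := h3.perm_rotated.length_eq.trans_le (Query.length_atomsAt_le i)
          rw [huv] at h1
          simp only [List.length_append, List.length_cons] at h1
          omega
        have hlt : ((Q.cand A t b i).filter fun y => (c2.iter b).key < y).card + 1 ≤
            (agreeing (N i) i t).card := by
          refine lt_of_lt_of_le (Finset.card_lt_card (Finset.filter_ssubset.2
            ⟨(c2.iter b).key, (hmoved b hb).key_mem (hend b hb), lt_irrefl _⟩)) hcard
        have := Nat.mul_le_mul_left Q.m hlt
        rw [Nat.mul_succ] at this
        simp only [potential, hiter3]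
        omega
      have hsum : ∑ x ∈ S with (c2.iter z).key ≤ x,
          stepBound Q.m N (i + 1) (Function.update t i x) ≤
          ∑ x ∈ S, stepBound Q.m N (i + 1) (Function.update t i x) :=
        Finset.sum_le_sum_of_subset (Finset.filter_subset _ _)
      -- The iterator `z` stands at its least key, so no result has a smaller value at `v_i` and
      -- starting the search from this key loses nothing.
      rw [← hfrom, Query.extensionsFrom_eq hi hz (Nat.zero_le _) (hmz.key_le (hend z hz))]
      refine (Returns.of_step (c' := step A τ c2) rfl (fun j hj => hj3 j hj.ne) (by rw [hs3])
        (h3.returns_of_search (by rw [hs3]) hw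
        (n := 4 * (Q.m * (agreeing (N i) i t).card) + 2 + ∑ x ∈ S with (c2.iter z).key ≤ x,
          stepBound Q.m N (i + 1) (Function.update t i x)) ?_)).mono (by omega)
      intro c5 hpc5 h5 hrot5 hiter5 hmax5
      rw [hiter3] at hmax5
      have := returns_of_loop (τ := τ) hi hcons (S := S)
        (fun x hx => Finset.mem_filter.2 ⟨hx b hb, hx⟩)
        (fun x c hc hx hcx => ih (i + 1) (by omega) _ c hc hx hcx) b
        (Q.m * (agreeing (N i) i t).card) c5 u v hpc5 h5 (by rw [hrot5, huv])
        (fun d hd => by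
          rw [hmax5, hiter5, ← hiter3]
          exact h3.key_le_getLast hw d hd)
        (by
          have : potential A t i b u c5 = potential A t i b u (step A τ c2) := by
            simp only [potential, hiter5]
          omega)
      rwa [hmax5] at this

theorem atPrefix_start (t : ℕ → ℕ) : AtPrefix t 0 (start Q) :=
  ⟨rfl, fun _ => List.Perm.refl _, fun j hj => absurd hj (Nat.not_lt_zero j), fun a =>
    ⟨(Query.depthAt_zero a).symm, fun _ hj => absurd hj (Nat.not_lt_zero _), rfl⟩⟩

/-- Correctness, with a bound for the number of steps. -/
theorem exists_haltsAt {N : ℕ → Finset (Fin k → ℕ)}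
    (hN : ∀ i < k, ∀ t, Q.Consistent A i t →
      ∃ b ∈ Q.atomsAt i, (Q.cand A t b i).card ≤ (agreeing (N i) i t).card) :
    ∃ n ≤ 11 + ∑ j ∈ Finset.range k, (4 * Q.m + 10) * (N j).card,
      ((step A τ)^[n] (start Q)).pc = .halt ∧ ((step A τ)^[n] (start Q)).out.Nodup ∧
      ∀ s, s ∈ ((step A τ)^[n] (start Q)).out ↔ s ∈ Q.result A := by
  obtain ⟨n, hn, c, l, h1, h2, h3, -, h5, h6, h7⟩ := returns_of_visit (τ := τ) hN k 0
    (Nat.zero_add k) (fun _ => 0) (start Q) rfl (atPrefix_start _) (fun a ha => by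
      rw [Query.depthAt_zero] at ha
      exact absurd ha (lt_irrefl 0))
  have hl := h3.level
  have hs : step A τ c = { c with pc := .halt, time := c.time + 1 } := by simp [step, h2, hl]
  have hout : c.out = l := by rw [h5]; exact List.append_nil l
  refine ⟨n + 1, ?_, ?_⟩
  · have : stepBound Q.m N 0 (fun _ => 0) ≤
        10 + ∑ j ∈ Finset.range k, (4 * Q.m + 10) * (N j).card := by
      unfold stepBound
      rw [Finset.range_eq_Ico]
      exact Nat.add_le_add_left (Finset.sum_le_sum fun j _ =>
        Nat.mul_le_mul_left _ (Finset.card_filter_le _ _)) _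
    omega
  · rw [Function.iterate_succ_apply', h1, hs]
    refine ⟨rfl, hout ▸ h6, fun s => ?_⟩
    simp only [hout]
    rw [h7]
    simp [Query.extensions]

end Visit

/-! ### From steps to time. -/

section Time

variable {σ : Type*} {ar : σ → ℕ} {k : ℕ} {Q : Query ar k} {A : Str ar} {τ : IterTime Q}

theorem length_iters_step {c : Config Q} (h : ∀ j, (c.join j).iters.length ≤ Q.m) :
    ∀ j, ((step A τ c).join j).iters.length ≤ Q.m := by
  have key : ∀ (J : Join Q.m), J.iters.length ≤ Q.m → ∀ i j,
      (Function.update c.join i J j).iters.length ≤ Q.m := by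
    intro J hJ i j
    by_cases hj : j = i
    · subst hj; rwa [Function.update_self]
    · rw [Function.update_of_ne hj]; exact h j
  intro j
  unfold step
  dsimp only
  split <;> (try split) <;> (try split) <;> (try split) <;>
    first
    | exact h j
    | exact key _ (by exact h (c.level - 1)) _ _
    | exact key _ (by exact (List.length_insertionSort _ _).trans_le (h (c.level - 1))) _ _

/-- The summands pay for opening or closing a variable, for one seek or next, for sorting with its
scan of the array, for writing a tuple, and for the remaining unit costs. Only the length of the
arrays matters, so the bound does not rely on correctness. -/
theorem time_step_le {c : Config Q} (h : ∀ j, (c.join j).iters.length ≤ Q.m) {T : ℕ}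
    (hT : ∀ a op, τ c a op ≤ T) :
    (step A τ c).time ≤ c.time + (Q.m * (1 + T) + T + Q.m ^ 2 + Q.m + k + 7) := by
  have hsum : ∀ i op, ((Q.atomsAt i).map fun a => 1 + τ c a op).sum ≤ Q.m * (1 + T) := by
    intro i op
    refine (List.sum_le_card_nsmul _ (1 + T) ?_).trans ?_
    · intro x hx
      obtain ⟨a, -, rfl⟩ := List.mem_map.1 hx
      exact Nat.add_le_add_left (hT a op) 1
    · rw [List.length_map, smul_eq_mul]
      exact Nat.mul_le_mul_right _ (Query.length_atomsAt_le i)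
  have hlen := h (c.level - 1)
  have hsq : (c.join (c.level - 1)).iters.length ^ 2 ≤ Q.m ^ 2 := Nat.pow_le_pow_left hlen 2
  have hd := hsum c.level .down
  have hu := hsum (c.level - 1) .up
  unfold step
  dsimp only
  split <;> (try split) <;> (try split) <;> (try split) <;> (try dsimp only) <;>
    first
    | omega
    | (rename_i a _ _
       have h1 := hT a .seek
       have h2 := hT a .next
       omega)
    | (rename_i a _ _ _
       have h1 := hT a .seek
       have h2 := hT a .next
       omega)

theorem time_iterate_le {T : ℕ} (hT : ∀ c a op, τ c a op ≤ T) (n : ℕ) :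
    ((step A τ)^[n] (start Q)).time ≤
      n * (Q.m * (1 + T) + T + Q.m ^ 2 + Q.m + k + 7) := by
  suffices (∀ j, (((step A τ)^[n] (start Q)).join j).iters.length ≤ Q.m) ∧
      ((step A τ)^[n] (start Q)).time ≤
        n * (Q.m * (1 + T) + T + Q.m ^ 2 + Q.m + k + 7) from this.2
  induction n with
  | zero => exact ⟨fun j => Query.length_atomsAt_le j, Nat.zero_le _⟩
  | succ n ih =>
    rw [Function.iterate_succ_apply', Nat.succ_mul]
    exact ⟨length_iters_step ih.1,
      (time_step_le ih.1 (hT _)).trans (Nat.add_le_add_right ih.2 _)⟩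

end Time

/-! ### Assembling the bound from the closure under renumbering. -/

section Main

variable {σ : Type*} {ar : σ → ℕ} {k : ℕ} {Q : Query ar k}

/-- Prefixes consistent with `A` are consistent with `B`, and candidate sets only grow from `A` to
`B`, so it suffices to renumber `B`. One set `N i` serves all prefixes `t` of the level. -/
theorem exists_results_bounding_cand {𝒦 : Set (Str ar)} (h𝒦 : ClosedUnderRenumbering 𝒦)
    {A B : Str ar} (hB𝒦 : B ∈ 𝒦) (hB : ∀ a, A (Q.rel a) ⊆ B (Q.rel a) ∧ (B (Q.rel a)).Nonempty) :
    ∃ N : ℕ → Finset (Fin k → ℕ), (∀ i, ∃ B' ∈ 𝒦, (N i).card = (Q.result B').ncard) ∧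
      ∀ i < k, ∀ t, Q.Consistent A i t →
        ∃ b ∈ Q.atomsAt i, (Q.cand A t b i).card ≤ (agreeing (N i) i t).card := by
  choose B' hB'𝒦 hB' using fun i => h𝒦.exists_renumberedAt (Q := Q) hB𝒦 i
  refine ⟨fun i => (Q.result_finite (B' i)).toFinset, fun i => ⟨B' i, hB'𝒦 i,
    (Set.ncard_eq_toFinset_card _ _).symm⟩, fun i hi t ht => ?_⟩
  have ht' : Q.Consistent B i t := fun a ha =>
    let ⟨u, hu, h⟩ := ht a ha
    ⟨u, (hB a).1 hu, h⟩
  obtain ⟨b, hb, hle⟩ := (hB' i).exists_card_cand_le hi (fun a => (hB a).2) ht'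
  exact ⟨b, hb, (Finset.card_le_card (Query.cand_mono (fun a => (hB a).1) t b i)).trans hle⟩

/-- After renumbering at depth `0`, every relation contains the zero tuple. -/
theorem ClosedUnderRenumbering.exists_one_le_ncard {𝒦 : Set (Str ar)}
    (h𝒦 : ClosedUnderRenumbering 𝒦) {B : Str ar} (hB𝒦 : B ∈ 𝒦)
    (hB : ∀ a, (B (Q.rel a)).Nonempty) : ∃ B' ∈ 𝒦, 1 ≤ (Q.result B').ncard := by
  obtain ⟨B', hB'𝒦, hB'⟩ := h𝒦.exists_renumberedAt (Q := Q) hB𝒦 0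
  refine ⟨B', hB'𝒦, (Set.ncard_pos (Q.result_finite B')).2 ⟨_, hB'.mem_result hB
    (t := fun _ => 0) (x := 0) (fun a ha => ?_) fun a ha => ?_⟩⟩
  · rw [Query.depthAt_zero] at ha
    exact absurd ha (lt_irrefl 0)
  · obtain ⟨u, hu⟩ := hB a
    exact Finset.card_pos.2 ⟨_, Query.mem_cand.2 ⟨u, hu, ⟨_, Query.depthAt_lt_of_mem ha⟩, rfl,
      fun j hj => absurd hj (Nat.not_lt_zero _), rfl⟩⟩

/-- Times are naturals, so the real bound may be rounded down. The absolute value keeps the bound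
monotone in the logarithm whatever the sign of `κ`. -/
theorem IterTime.Meets.le_floor {τ : IterTime Q} {κ : ℝ} {A : Str ar} (hτ : τ.Meets κ A) {M : ℕ}
    (hM : ∀ R, (A R).card ≤ M) (c : Config Q) (a : Fin Q.m) (op : IterOp) :
    τ c a op ≤ ⌊|κ| * max 1 (Real.logb 2 M)⌋₊ := by
  refine Nat.le_floor ((hτ c a op).trans ?_)
  refine mul_le_mul (le_abs_self κ) (max_le (le_max_left _ _) ?_)
    (le_trans zero_le_one (le_max_left _ _)) (abs_nonneg κ)
  rcases Nat.eq_zero_or_pos (A (Q.rel a)).card with h0 | h0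
  · rw [h0]
    simp
  · exact (Real.logb_le_logb_of_le one_lt_two (by exact_mod_cast h0)
      (by exact_mod_cast hM (Q.rel a))).trans (le_max_right _ _)

end Main

end LFTJ

theorem mainTheorem1 {σ : Type*} {ar : σ → ℕ} {k : ℕ} (Q : LFTJ.Query ar k) (κ : ℝ) :
    ∃ C : ℝ, ∀ (K : ℕ → Set (LFTJ.Str ar)) (q M : ℕ → ℕ),
      Monotone K →
      (∀ n, LFTJ.ClosedUnderRenumbering (K n)) →
      (∀ n, IsLUB {s : ℕ | ∃ A ∈ K n, s = (Q.result A).ncard} (q n)) →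
      (∀ n, IsLUB {s : ℕ | ∃ A ∈ K n, ∃ R : σ, s = (A R).card} (M n)) →
      ∀ n, ∀ A ∈ K n, ∀ τ : LFTJ.IterTime Q, τ.Meets κ A →
        ∃ c : LFTJ.Config Q, LFTJ.HaltsAt A τ c ∧
          c.out.Nodup ∧ (∀ t, t ∈ c.out ↔ t ∈ Q.result A) ∧
          ((∃ B ∈ K n, ∀ a : Fin Q.m,
              A (Q.rel a) ⊆ B (Q.rel a) ∧ (B (Q.rel a)).Nonempty) →
            (c.time : ℝ) ≤ C * q n * max 1 (Real.logb 2 (M n))) := by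
  -- The first factor bounds the steps per unit of `q n`, with `11` for the constant of `stepBound`
  -- and the halting step; the second bounds the time of a step per unit of `max 1 (log M)`.
  refine ⟨(11 + k * (4 * Q.m + 10)) *
    (Q.m * (1 + |κ|) + |κ| + Q.m ^ 2 + Q.m + k + 7), ?_⟩
  intro K q M _ hK hq hM n A hA τ hτ
  by_cases hB : ∃ B ∈ K n, ∀ a : Fin Q.m, A (Q.rel a) ⊆ B (Q.rel a) ∧ (B (Q.rel a)).Nonempty
  · obtain ⟨B, hBK, hB⟩ := hB
    obtain ⟨N, hNq, hN⟩ := LFTJ.exists_results_bounding_cand (hK n) hBK hB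
    obtain ⟨B₀, hB₀, hone⟩ := (hK n).exists_one_le_ncard (Q := Q) hBK fun a => (hB a).2
    obtain ⟨s, hs, hhalt, hnd, hout⟩ := LFTJ.exists_haltsAt (τ := τ) hN
    refine ⟨_, ⟨hhalt, s, rfl⟩, hnd, hout, fun _ => ?_⟩
    have hq1 : 1 ≤ q n := hone.trans ((hq n).1 ⟨B₀, hB₀, rfl⟩)
    have hs' : s ≤ (11 + k * (4 * Q.m + 10)) * q n := by
      have : ∑ j ∈ Finset.range k, (4 * Q.m + 10) * (N j).card ≤
          k * ((4 * Q.m + 10) * q n) := by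
        refine (Finset.sum_le_card_nsmul _ _ ((4 * Q.m + 10) * q n) fun j _ => ?_).trans ?_
        · obtain ⟨B', hB', hcard⟩ := hNq j
          exact Nat.mul_le_mul_left _ (hcard.trans_le ((hq n).1 ⟨B', hB', rfl⟩))
        · rw [Finset.card_range, smul_eq_mul]
      calc s ≤ 11 + k * ((4 * Q.m + 10) * q n) := hs.trans (Nat.add_le_add_left this _)
        _ ≤ 11 * q n + k * ((4 * Q.m + 10) * q n) := by omega
        _ = (11 + k * (4 * Q.m + 10)) * q n := by ring
    set L := max 1 (Real.logb 2 (M n)) with hL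
    have hL1 : 1 ≤ L := le_max_left _ _
    have htime := LFTJ.time_iterate_le (A := A)
      (hτ.le_floor fun R => (hM n).1 ⟨A, hA, R, rfl⟩) s
    set T := ⌊|κ| * L⌋₊ with hTdef
    have hT : (T : ℝ) ≤ |κ| * L := Nat.floor_le (by positivity)
    have hstep : ((Q.m * (1 + T) + T + Q.m ^ 2 + Q.m + k + 7 : ℕ) : ℝ) ≤
        (Q.m * (1 + |κ|) + |κ| + Q.m ^ 2 + Q.m + k + 7) * L := by
      push_cast
      have h1 : (Q.m : ℝ) * (1 + T) ≤ Q.m * ((1 + |κ|) * L) :=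
        mul_le_mul_of_nonneg_left (by linarith) (Nat.cast_nonneg _)
      have h2 : (Q.m ^ 2 + Q.m + k + 7 : ℝ) * 1 ≤ (Q.m ^ 2 + Q.m + k + 7) * L :=
        mul_le_mul_of_nonneg_left hL1 (by positivity)
      linarith
    have htime' := (Nat.cast_le (α := ℝ)).2 htime
    rw [Nat.cast_mul] at htime'
    have hs'' := (Nat.cast_le (α := ℝ)).2 hs'
    push_cast at hs''
    refine htime'.trans ((mul_le_mul hs'' hstep (Nat.cast_nonneg _) (by positivity)).trans_eq ?_)
    ring
  -- Only correctness is claimed here, so any finite step bound will do: the class of all structures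
  -- is closed under renumbering, and adding the zero tuple makes every relation nonempty.
  · have hB' : ∀ a, A (Q.rel a) ⊆ insert 0 (A (Q.rel a)) ∧ (insert 0 (A (Q.rel a))).Nonempty :=
      fun a => ⟨Finset.subset_insert _ _, Finset.insert_nonempty _ _⟩
    obtain ⟨N, -, hN⟩ := LFTJ.exists_results_bounding_cand (𝒦 := Set.univ) (Q := Q)
      (fun _ _ _ _ => Set.mem_univ _) (B := fun R => insert 0 (A R)) (Set.mem_univ _) hB'
    obtain ⟨s, -, hhalt, hnd, hout⟩ := LFTJ.exists_haltsAt (τ := τ) hN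
    exact ⟨_, ⟨hhalt, s, rfl⟩, hnd, hout, fun h => absurd h hB⟩
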